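/- Let $m\ge 6$ be even. Let $H_m$ be the binary $m\times\binom m2$ matrix whose columns are all the binary vectors of length $m$ and weight $2$, each occurring once, and let $C^{(m)}$ be the binary linear code of length $\binom m2$ with parity check matrix $H_m$. Write $d(x,C)$ for the Hamming distance of a vector $x$ from a code $C$, $\rho(C)=\max_x d(x,C)$ for its covering radius and $C(i)=\{x: d(x,C)=i\}$. Put $C^{[m]}=C^{(m)}\cup C^{(m)}(\rho(C^{(m)}))$. A code $C$ with covering radius $\rho$ is completely regular with intersection array $(b_0,\dots,b_{\rho-1};c_1,\dots,c_\rho)$ if each $x\in C(i)$ has exactly $b_i$ neighbours (vectors at Hamming distance $1$) in $C(i+1)$ for $0\le i<\rho$, and exactly $c_i$ neighbours in $C(i-1)$ for $1\le i\le\rho$. The coset graph of $C$ has the cosets $C+x$ as vertices, two distinct cosets being adjacent when they contain vectors at Hamming distance $1$. Let $\Gamma^{(m)}$ and $\Gamma^{[m]}$ be the coset graphs of $C^{(m)}$ and $C^{[m]}$. Then $C^{[m]}$ is linear, and the following hold. (i) $\Gamma^{(m)}$ and $\Gamma^{[m]}$ are connected, have $2^{m-1}$ and $2^{m-2}$ vertices,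 and have diameters $m/2$ and $\lfloor m/4\rfloor$, which are also the covering radii of $C^{(m)}$ and $C^{[m]}$. The map sending a coset of $C^{(m)}$ to the coset of $C^{[m]}$ containing it makes $\Gamma^{(m)}$ a double cover of $\Gamma^{[m]}$: all its fibres have two elements, and it maps the neighbours of each vertex bijectively onto the neighbours of its image. (ii) The codes are completely regular, the graphs are distance-regular, and each graph has the same intersection array $(b_0,\dots,b_{\rho-1};c_1,\dots,c_\rho)$ as its code. For $\Gamma^{(m)}$, with $\rho=m/2$, it is given by $b_i=\binom{m-2i}{2}$ and $c_i=\binom{2i}{2}$. For $\Gamma^{[m]}$, with $\rho=\lfloor m/4\rfloor$, it is given by the same formulas, except that $c_\rho=2\binom{2\rho}{2}$ if $m\equiv 0\pmod 4$. (iii) Both graphs are distance-transitive: for vertices $u,v,u',v'$ with $d(u,v)=d(u',v')$ there is an automorphism taking $u$ to $u'$ and $v$ to $v'$. (iv) Call a connected graph primitive if, for each $i$ from $1$ to its diameter, the graph on the same vertices that joins the pairs at distance $i$ is connected, and imprimitive otherwise. Then $\Gamma^{(m)}$ is imprimitive and $\Gamma^{[m]}$ is primitive. (v) Put $\rho=\lfloor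 m/4\rfloor$. The set of eigenvalues of the adjacency matrix of $\Gamma^{[m]}$ is $$\Big\{\tbinom m2-8i(2\rho+1-i): i=0,1,\dots,\rho\Big\}\quad\text{if } m\equiv 2\pmod 4,$$ $$\Big\{\tbinom m2-8i(2\rho-i): i=0,1,\dots,\rho\Big\}\quad\text{if } m\equiv 0\pmod 4.$$ -/

import Mathlib

namespace CosetCode

open scoped Classical

/-! ### Binary codes -/

section Codes

variable {ι : Type*} [Fintype ι]

/-- The distance `d(v, C) = min {d(v, x) : x ∈ C}` from a vector to a (nonempty) binary code. -/
noncomputable def distTo (C : Set (ι → ZMod 2)) (v : ι → ZMod 2) : ℕ :=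
  sInf {d : ℕ | ∃ x ∈ C, hammingDist v x = d}

/-- The covering radius `max {d(v, C) : v ∈ 𝔽₂ⁿ}`. -/
noncomputable def coveringRadius (C : Set (ι → ZMod 2)) : ℕ :=
  Finset.univ.sup (distTo C)

/-- The set `C(i)` of all vectors at distance `i` from `C`. -/
def layer (C : Set (ι → ZMod 2)) (i : ℕ) : Set (ι → ZMod 2) :=
  {x | distTo C x = i}

/-- `C` is completely regular with covering radius `ρ` and intersection array
`(b 0, …, b (ρ - 1); c 1, …, c ρ)`. Only these values of `b` and `c` matter; the remaining numbers
`c_0` and `b_ρ` of the array are `0`. -/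
structure IsCompletelyRegularWith (C : Set (ι → ZMod 2)) (ρ : ℕ) (b c : ℕ → ℕ) : Prop where
  coveringRadius_eq : coveringRadius C = ρ
  up : ∀ i < ρ, ∀ x ∈ layer C i,
    {y | hammingDist x y = 1 ∧ y ∈ layer C (i + 1)}.ncard = b i
  down : ∀ i, 1 ≤ i → i ≤ ρ → ∀ x ∈ layer C i,
    {y | hammingDist x y = 1 ∧ y ∈ layer C (i - 1)}.ncard = c i

/-- The vertices of the coset graph of `C`: the cosets `C + x`. -/
def Coset (C : Set (ι → ZMod 2)) : Type _ :=
  {D : Set (ι → ZMod 2) // ∃ x, D = (fun v => v + x) '' C}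

noncomputable instance (C : Set (ι → ZMod 2)) : Fintype (Coset C) :=
  Fintype.ofInjective (fun D : Coset C => D.1) Subtype.val_injective

/-- The coset graph of `C`: distinct cosets are adjacent when they contain vectors at Hamming
distance one. -/
def cosetGraph (C : Set (ι → ZMod 2)) : SimpleGraph (Coset C) where
  Adj D D' := D ≠ D' ∧ ∃ v ∈ D.1, ∃ v' ∈ D'.1, hammingDist v v' = 1
  symm := ⟨by
    rintro D D' ⟨hne, v, hv, v', hv', h⟩
    exact ⟨hne.symm, v', hv', v, hv, by rw [hammingDist_comm]; exact h⟩⟩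
  loopless := ⟨fun _ h => h.1 rfl⟩

end Codes

/-! ### The codes `C^{(m)}` and `C^{[m]}` -/

/-- The binary vectors of length `m` and weight `2`. -/
abbrev WeightTwo (m : ℕ) : Type :=
  {v : Fin m → ZMod 2 // hammingNorm v = 2}

/-- The matrix `H_m`, each vector of length `m` and weight `2` occurring once as a column. -/
def parityCheck (m : ℕ) : Matrix (Fin m) (WeightTwo m) (ZMod 2) :=
  Matrix.of fun i e => e.1 i

/-- The linear code `C^{(m)}` with parity check matrix `H_m`. -/
def codeRound (m : ℕ) : Submodule (ZMod 2) (WeightTwo m → ZMod 2) :=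
  LinearMap.ker (parityCheck m).mulVecLin

/-- The code `C^{[m]} = C^{(m)} ∪ C^{(m)}(ρ)`, where `ρ` is the covering radius of `C^{(m)}`. -/
def codeSquare (m : ℕ) : Set (WeightTwo m → ZMod 2) :=
  (codeRound m : Set (WeightTwo m → ZMod 2)) ∪
    layer (codeRound m : Set (WeightTwo m → ZMod 2))
      (coveringRadius (codeRound m : Set (WeightTwo m → ZMod 2)))

/-- The graph `Γ^{(m)}`. -/
abbrev graphRound (m : ℕ) : SimpleGraph (Coset (codeRound m : Set (WeightTwo m → ZMod 2))) :=
  cosetGraph (codeRound m : Set (WeightTwo m → ZMod 2))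

/-- The graph `Γ^{[m]}`. -/
abbrev graphSquare (m : ℕ) : SimpleGraph (Coset (codeSquare m)) :=
  cosetGraph (codeSquare m)

/-! ### Graphs -/

section Graphs

variable {V W : Type*}

/-- `G` is distance-regular of diameter `ρ` with intersection array
`(b 0, …, b (ρ - 1); c 1, …, c ρ)`. -/
structure IsDistanceRegularWith (G : SimpleGraph V) (ρ : ℕ) (b c : ℕ → ℕ) : Prop where
  connected : G.Connected
  diam_eq : G.diam = ρ
  regular : ∃ k : ℕ, ∀ v, (G.neighborSet v).ncard = k
  up : ∀ i < ρ, ∀ u v, G.dist u v = i →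
    {w | G.Adj v w ∧ G.dist u w = i + 1}.ncard = b i
  down : ∀ i, 1 ≤ i → i ≤ ρ → ∀ u v, G.dist u v = i →
    {w | G.Adj v w ∧ G.dist u w = i - 1}.ncard = c i

/-- A connected graph is distance-transitive if its automorphism group is transitive on the ordered
pairs of vertices at any given distance. -/
def IsDistanceTransitive (G : SimpleGraph V) : Prop :=
  G.Connected ∧ ∀ u v u' v', G.dist u v = G.dist u' v' → ∃ π : G ≃g G, π u = u' ∧ π v = v'

/-- The graph on the vertices of `G` whose edges are the pairs at distance `i` in `G`. -/
def distanceGraph (G : SimpleGraph V) (i : ℕ) : SimpleGraph V where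
  Adj u v := u ≠ v ∧ G.dist u v = i
  symm := ⟨fun _ _ h => ⟨h.1.symm, by rw [SimpleGraph.dist_comm]; exact h.2⟩⟩
  loopless := ⟨fun _ h => h.1 rfl⟩

/-- `G` is primitive: it is connected and so are its distance-`i` graphs for `1 ≤ i ≤ diam G`. A
graph is imprimitive if it is not primitive. -/
def IsPrimitive (G : SimpleGraph V) : Prop :=
  G.Connected ∧ ∀ i, 1 ≤ i → i ≤ G.diam → (distanceGraph G i).Connected

/-- The map `f` is a twofold covering of graphs: every fibre has two elements, and `f` maps the
neighbours of each vertex `v` bijectively onto the neighbours of `f v`. -/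
def IsDoubleCover (G : SimpleGraph V) (H : SimpleGraph W) (f : V → W) : Prop :=
  (∀ w, (f ⁻¹' {w}).ncard = 2) ∧ ∀ v, Set.BijOn f (G.neighborSet v) (H.neighborSet (f v))

/-- The set of eigenvalues of (the adjacency matrix of) a finite graph. -/
def eigenvalues [Fintype V] (G : SimpleGraph V) : Set ℝ :=
  {θ | Module.End.HasEigenvalue (Matrix.toLin' (G.adjMatrix ℝ)) θ}

end Graphs

/-! ### The intersection numbers -/

/-- `b_i = binom (m - 2i) 2`. -/
def arrB (m i : ℕ) : ℕ := (m - 2 * i).choose 2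

/-- `c_i = binom (2i) 2`, the numbers for `C^{(m)}`. -/
def arrC (i : ℕ) : ℕ := (2 * i).choose 2

/-- The numbers `c_i` for `C^{[m]}`: `binom (2i) 2`, except that `c_ρ = 2 * binom (2ρ) 2` for
`ρ = m / 4` when `4 ∣ m`. -/
def arrCSquare (m i : ℕ) : ℕ :=
  if m % 4 = 0 ∧ i = m / 4 then 2 * (2 * i).choose 2 else (2 * i).choose 2

end CosetCode

/-!
Let `σ x = H_m x` be the syndrome map. The codes `C^{(m)}` and `C^{[m]}` are the preimages under `σ`
of `0` and of `{0, 1}`, so their coset graphs are Cayley graphs on the vectors of even weight in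
`𝔽₂ᵐ`, respectively on these vectors modulo the all-one vector, generated by the vectors of weight
two: the halved `m`-cube and the folded halved `m`-cube. A vector of even weight `w` is a sum of
`w / 2` but not fewer vectors of weight two, so the distance of `x` from the code is half the
(folded) weight of `σ x`. The intersection numbers then count the vectors `e` of weight two with a
given number of ones inside the support of `v = σ x`, since this number determines the weight of
`v + e`. Permutations of the `m` coordinates are transitive on the vectors of each weight, which
gives distance-transitivity.

The eigenfunctions of the coset graph of a linear code are the characters `x ↦ (-1) ^ (y ⬝ᵥ x)` for
`y` in the dual code, with eigenvalue `n - 2 wt(y)`. The dual of `C^{[m]}` consists of the vectors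
`uᵀ H_m` with `u` of even weight `w`, and `uᵀ H_m` has weight `w (m - w)`.
-/

namespace CosetCode

section Hamming

lemma add_single_injective {ι : Type*} [DecidableEq ι] (x : ι → ZMod 2) :
    Function.Injective fun j => x + Pi.single j (1 : ZMod 2) := fun j k h => by
  simpa [Pi.single_apply] using congrFun (add_left_cancel h) j

variable {ι : Type*} [Fintype ι]

lemma hammingDist_eq_hammingNorm_sub {β : ι → Type*} [∀ i, DecidableEq (β i)]
    [∀ i, AddCommGroup (β i)] (x y : ∀ i, β i) : hammingDist x y = hammingNorm (x - y) := by
  rw [hammingDist_comm, hammingDist_eq_hammingNorm, neg_add_eq_sub]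

lemma exists_hammingDist_eq_and_eq_one {β : ι → Type*} [∀ i, DecidableEq (β i)] {n : ℕ}
    {x y : ∀ i, β i} (h : hammingDist x y = n + 1) :
    ∃ z, hammingDist x z = n ∧ hammingDist z y = 1 := by
  classical
  obtain ⟨j, hj⟩ := Function.ne_iff.1 (hammingDist_ne_zero.1 (by omega : hammingDist x y ≠ 0))
  refine ⟨Function.update y j (x j), ?_, ?_⟩
  · have herase : ({i | x i ≠ Function.update y j (x j) i} : Finset ι) =
        ({i | x i ≠ y i} : Finset ι).erase j := by
      ext i
      by_cases hij : i = j
      · subst hij; simp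
      · simp [hij]
    rw [hammingDist, herase, Finset.card_erase_of_mem (by simpa using hj)]
    exact Nat.sub_eq_of_eq_add h
  · rw [hammingDist, Finset.card_eq_one]
    refine ⟨j, ?_⟩
    ext i
    by_cases hij : i = j
    · subst hij; simpa using hj
    · simp [hij]

lemma zmod_two_eq_one {a : ZMod 2} (h : a ≠ 0) : a = 1 := by
  revert a; decide

variable [DecidableEq ι]

lemma hammingNorm_single {β : ι → Type*} [∀ i, DecidableEq (β i)] [∀ i, Zero (β i)] (j : ι)
    {a : β j} (ha : a ≠ 0) : hammingNorm (Pi.single j a) = 1 := by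
  rw [hammingNorm, Finset.card_eq_one]
  refine ⟨j, ?_⟩
  ext i
  by_cases h : i = j
  · subst h; simpa using ha
  · simp [h]

lemma hammingDist_eq_one_iff {x y : ι → ZMod 2} :
    hammingDist x y = 1 ↔ ∃ j, x + Pi.single j 1 = y := by
  constructor
  · intro h
    obtain ⟨j, hj⟩ := Finset.card_eq_one.1 h
    have hmem (i : ι) : x i ≠ y i ↔ i = j := by simpa using Finset.ext_iff.1 hj i
    refine ⟨j, funext fun i => ?_⟩
    by_cases hij : i = j
    · subst hij
      have hne : y i - x i ≠ 0 := sub_ne_zero.2 ((hmem i).2 rfl).symm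
      simp [← zmod_two_eq_one hne]
    · simpa [hij] using not_not.1 (mt (hmem i).1 hij)
  · rintro ⟨j, rfl⟩
    rw [hammingDist_comm, hammingDist_eq_hammingNorm_sub, add_sub_cancel_left,
      hammingNorm_single j one_ne_zero]

lemma ncard_hammingDist_eq_one_and (x : ι → ZMod 2) (P : (ι → ZMod 2) → Prop) :
    {y | hammingDist x y = 1 ∧ P y}.ncard = {j | P (x + Pi.single j 1)}.ncard := by
  rw [← Set.ncard_image_of_injective _ (add_single_injective x)]
  congr 1
  ext y
  simp only [Set.mem_ofPred_eq, hammingDist_eq_one_iff, Set.mem_image]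
  constructor
  · rintro ⟨⟨j, rfl⟩, h⟩
    exact ⟨j, h, rfl⟩
  · rintro ⟨j, h, rfl⟩
    exact ⟨⟨j, rfl⟩, h⟩

end Hamming

section Cosets

variable {ι : Type*} {C : Submodule (ZMod 2) (ι → ZMod 2)} {x y : ι → ZMod 2}

/-- The coset `C + x` of a linear code, as a vertex of its coset graph. -/
def cosetOf (C : Submodule (ZMod 2) (ι → ZMod 2)) (x : ι → ZMod 2) :
    Coset (C : Set (ι → ZMod 2)) :=
  ⟨(fun v => v + x) '' (C : Set (ι → ZMod 2)), x, rfl⟩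

lemma mem_cosetOf : y ∈ (cosetOf C x).1 ↔ y - x ∈ C := by
  simp [cosetOf, sub_eq_add_neg]

lemma cosetOf_eq_iff : cosetOf C x = cosetOf C y ↔ x - y ∈ C := by
  refine ⟨fun h => ?_, fun h => Subtype.ext <| Set.ext fun z => ?_⟩
  · rw [← mem_cosetOf, ← h, mem_cosetOf, sub_self]
    exact C.zero_mem
  · rw [mem_cosetOf, mem_cosetOf, ← sub_add_sub_cancel z x y, C.add_mem_iff_left h]

lemma cosetOf_surjective : Function.Surjective (cosetOf C) := by
  rintro ⟨_, x, rfl⟩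
  exact ⟨x, rfl⟩

lemma cosetOf_eq_iff_mem {D : Coset (C : Set (ι → ZMod 2))} : cosetOf C x = D ↔ x ∈ D.1 := by
  obtain ⟨y, rfl⟩ := cosetOf_surjective D
  rw [cosetOf_eq_iff, mem_cosetOf]

instance : Nonempty (Coset (C : Set (ι → ZMod 2))) := ⟨cosetOf C 0⟩

end Cosets

section Distance

variable {ι : Type*} [Fintype ι] {C : Submodule (ZMod 2) (ι → ZMod 2)} {x y : ι → ZMod 2}

lemma distTo_le_iff {n : ℕ} :
    distTo (C : Set (ι → ZMod 2)) x ≤ n ↔ ∃ z, x - z ∈ C ∧ hammingNorm z ≤ n := by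
  constructor
  · intro h
    have hne : {d : ℕ | ∃ c ∈ (C : Set (ι → ZMod 2)), hammingDist x c = d}.Nonempty :=
      ⟨_, 0, C.zero_mem, rfl⟩
    obtain ⟨c, hc, hd⟩ := Nat.sInf_mem hne
    refine ⟨x - c, by rwa [sub_sub_cancel], ?_⟩
    rw [← hammingDist_eq_hammingNorm_sub, hd]
    exact h
  · rintro ⟨z, hz, hn⟩
    have h : distTo (C : Set (ι → ZMod 2)) x ≤ hammingDist x (x - z) :=
      Nat.sInf_le ⟨x - z, hz, rfl⟩
    rw [hammingDist_eq_hammingNorm_sub, sub_sub_cancel] at h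
    exact h.trans hn

lemma coveringRadius_eq {K : Set (ι → ZMod 2)} {ρ : ℕ} (hle : ∀ x, distTo K x ≤ ρ)
    (hex : ∃ x, distTo K x = ρ) : coveringRadius K = ρ := by
  obtain ⟨x, rfl⟩ := hex
  exact le_antisymm (Finset.sup_le fun y _ => hle y)
    (Finset.le_sup (f := distTo K) (@Finset.mem_univ _ (_) x))

lemma cosetGraph_adj_cosetOf_iff {D : Coset (C : Set (ι → ZMod 2))} :
    (cosetGraph (C : Set (ι → ZMod 2))).Adj (cosetOf C x) D ↔
      cosetOf C x ≠ D ∧ ∃ y, hammingDist x y = 1 ∧ cosetOf C y = D := by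
  refine and_congr_right fun _ => ⟨?_, ?_⟩
  · rintro ⟨v, hv, v', hv', h⟩
    refine ⟨x - v + v', ?_, ?_⟩
    · rw [← h, hammingDist_eq_hammingNorm_sub, hammingDist_eq_hammingNorm_sub]
      congr 1
      abel
    · rw [← cosetOf_eq_iff_mem.2 hv', cosetOf_eq_iff, add_sub_cancel_right, ← neg_sub]
      exact C.neg_mem (mem_cosetOf.1 hv)
  · rintro ⟨y, h, hy⟩
    exact ⟨x, cosetOf_eq_iff_mem.1 rfl, y, cosetOf_eq_iff_mem.1 hy, h⟩

lemma exists_walk_length_le_hammingDist (C : Submodule (ZMod 2) (ι → ZMod 2)) (x y : ι → ZMod 2) :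
    ∃ w : (cosetGraph (C : Set (ι → ZMod 2))).Walk (cosetOf C x) (cosetOf C y),
      w.length ≤ hammingDist x y := by
  induction hn : hammingDist x y generalizing y with
  | zero =>
    obtain rfl := hammingDist_eq_zero.1 hn
    exact ⟨.nil, le_rfl⟩
  | succ n ih =>
    obtain ⟨z, hxz, hzy⟩ := exists_hammingDist_eq_and_eq_one hn
    obtain ⟨w, hw⟩ := ih z hxz
    by_cases h : cosetOf C z = cosetOf C y
    · rw [← h]
      exact ⟨w, hw.trans n.le_succ⟩
    · refine ⟨w.concat (cosetGraph_adj_cosetOf_iff.2 ⟨h, y, hzy, rfl⟩), ?_⟩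
      rw [SimpleGraph.Walk.length_concat]
      omega

lemma exists_hammingDist_le_walk_length {D D' : Coset (C : Set (ι → ZMod 2))}
    (w : (cosetGraph (C : Set (ι → ZMod 2))).Walk D D') (hx : cosetOf C x = D) :
    ∃ y, cosetOf C y = D' ∧ hammingDist x y ≤ w.length := by
  induction w generalizing x with
  | nil => exact ⟨x, hx, by simp⟩
  | cons hadj w ih =>
    subst hx
    obtain ⟨-, z, hxz, hz⟩ := cosetGraph_adj_cosetOf_iff.1 hadj
    obtain ⟨y, hy, hzy⟩ := ih hz
    refine ⟨y, hy, (hammingDist_triangle x z y).trans ?_⟩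
    rw [SimpleGraph.Walk.length_cons]
    omega

lemma cosetGraph_connected (C : Submodule (ZMod 2) (ι → ZMod 2)) :
    (cosetGraph (C : Set (ι → ZMod 2))).Connected := by
  refine ⟨fun D D' => ?_⟩
  obtain ⟨x, rfl⟩ := cosetOf_surjective D
  obtain ⟨y, rfl⟩ := cosetOf_surjective D'
  exact ⟨(exists_walk_length_le_hammingDist C x y).choose⟩

lemma cosetGraph_dist (x y : ι → ZMod 2) :
    (cosetGraph (C : Set (ι → ZMod 2))).dist (cosetOf C x) (cosetOf C y) =
      distTo (C : Set (ι → ZMod 2)) (y - x) := by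
  apply le_antisymm
  · obtain ⟨z, hz, hn⟩ := distTo_le_iff.1 (le_refl (distTo (C : Set (ι → ZMod 2)) (y - x)))
    obtain ⟨w, hw⟩ := exists_walk_length_le_hammingDist C x (x + z)
    have hy : cosetOf C (x + z) = cosetOf C y := by
      rw [eq_comm, cosetOf_eq_iff, ← sub_sub]
      exact hz
    rw [hammingDist_comm, hammingDist_eq_hammingNorm_sub, add_sub_cancel_left] at hw
    rw [← hy]
    exact (SimpleGraph.dist_le w).trans (hw.trans hn)
  · obtain ⟨w, hw⟩ :=
      (cosetGraph_connected C).exists_walk_length_eq_dist (cosetOf C x) (cosetOf C y)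
    obtain ⟨y', hy, hn⟩ := exists_hammingDist_le_walk_length w rfl
    refine distTo_le_iff.2 ⟨y' - x, ?_, ?_⟩
    · rw [sub_sub_sub_cancel_right]
      exact cosetOf_eq_iff.1 hy.symm
    · rw [← hw, ← hammingDist_eq_hammingNorm_sub, hammingDist_comm]
      exact hn

lemma cosetGraph_diam (C : Submodule (ZMod 2) (ι → ZMod 2)) :
    (cosetGraph (C : Set (ι → ZMod 2))).diam = coveringRadius (C : Set (ι → ZMod 2)) := by
  refine (coveringRadius_eq (fun x => ?_) ?_).symm
  · rw [← sub_zero x, ← cosetGraph_dist]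
    exact SimpleGraph.dist_le_diam
      (SimpleGraph.connected_iff_ediam_ne_top.1 (cosetGraph_connected C))
  · obtain ⟨D, D', h⟩ := (cosetGraph (C : Set (ι → ZMod 2))).exists_dist_eq_diam
    obtain ⟨x, rfl⟩ := cosetOf_surjective D
    obtain ⟨y, rfl⟩ := cosetOf_surjective D'
    exact ⟨y - x, by rw [← cosetGraph_dist, h]⟩

end Distance

section OneErrorCorrecting

variable {ι : Type*} [Fintype ι] {C C' : Submodule (ZMod 2) (ι → ZMod 2)}

/-- A linear code that corrects one error, that is, whose minimum distance is at least three. The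
coset graph of such a code looks locally like the Hamming graph. -/
def IsOneErrorCorrecting (C : Submodule (ZMod 2) (ι → ZMod 2)) : Prop :=
  ∀ c ∈ C, hammingNorm c ≤ 2 → c = 0

lemma IsOneErrorCorrecting.mono (hC : IsOneErrorCorrecting C') (hle : C ≤ C') :
    IsOneErrorCorrecting C := fun c hc => hC c (hle hc)

lemma IsOneErrorCorrecting.bijOn_cosetOf (hC : IsOneErrorCorrecting C) (x : ι → ZMod 2) :
    Set.BijOn (cosetOf C) {y | hammingDist x y = 1}
      ((cosetGraph (C : Set (ι → ZMod 2))).neighborSet (cosetOf C x)) := by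
  have eq_of_cosetOf_eq {y z : ι → ZMod 2} (hyz : hammingDist y z ≤ 2)
      (h : cosetOf C y = cosetOf C z) : y = z := by
    rw [hammingDist_eq_hammingNorm_sub] at hyz
    exact sub_eq_zero.1 (hC _ (cosetOf_eq_iff.1 h) hyz)
  refine ⟨fun y (hy : hammingDist x y = 1) => ?_, fun y hy z hz h => ?_, fun D hD => ?_⟩
  · refine cosetGraph_adj_cosetOf_iff.2 ⟨fun h => ?_, y, hy, rfl⟩
    have hxy := eq_of_cosetOf_eq (by omega) h
    exact hammingDist_ne_zero.1 (by omega) hxy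
  · have h1 : hammingDist x y = 1 := hy
    have h2 : hammingDist x z = 1 := hz
    have h3 := hammingDist_triangle_left y z x
    exact eq_of_cosetOf_eq (by omega) h
  · exact (cosetGraph_adj_cosetOf_iff.1 hD).2

lemma IsOneErrorCorrecting.ncard_adj_and (hC : IsOneErrorCorrecting C) (x : ι → ZMod 2)
    (P : Coset (C : Set (ι → ZMod 2)) → Prop) :
    {D | (cosetGraph (C : Set (ι → ZMod 2))).Adj (cosetOf C x) D ∧ P D}.ncard =
      {y | hammingDist x y = 1 ∧ P (cosetOf C y)}.ncard := by
  have himage : {D | (cosetGraph (C : Set (ι → ZMod 2))).Adj (cosetOf C x) D ∧ P D} =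
      cosetOf C '' {y | hammingDist x y = 1 ∧ P (cosetOf C y)} := by
    refine Set.ext fun D => ⟨fun ⟨hadj, hP⟩ => ?_, ?_⟩
    · obtain ⟨y, hy, rfl⟩ := (hC.bijOn_cosetOf x).surjOn hadj
      exact ⟨y, ⟨hy, hP⟩, rfl⟩
    · rintro ⟨y, ⟨hy, hP⟩, rfl⟩
      exact ⟨(hC.bijOn_cosetOf x).mapsTo hy, hP⟩
  rw [himage, ((hC.bijOn_cosetOf x).injOn.mono fun y hy => hy.1).ncard_image]

lemma IsOneErrorCorrecting.ncard_neighborSet (hC : IsOneErrorCorrecting C)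
    (D : Coset (C : Set (ι → ZMod 2))) :
    ((cosetGraph (C : Set (ι → ZMod 2))).neighborSet D).ncard = Fintype.card ι := by
  classical
  obtain ⟨x, rfl⟩ := cosetOf_surjective D
  rw [← (hC.bijOn_cosetOf x).image_eq, (hC.bijOn_cosetOf x).injOn.ncard_image]
  simpa using ncard_hammingDist_eq_one_and x fun _ => True

lemma IsOneErrorCorrecting.ncard_adj_and_dist_eq (hC : IsOneErrorCorrecting C)
    (x y : ι → ZMod 2) (k : ℕ) :
    {D | (cosetGraph (C : Set (ι → ZMod 2))).Adj (cosetOf C y) D ∧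
        (cosetGraph (C : Set (ι → ZMod 2))).dist (cosetOf C x) D = k}.ncard =
      {z | hammingDist (y - x) z = 1 ∧ z ∈ layer (C : Set (ι → ZMod 2)) k}.ncard := by
  classical
  simp only [hC.ncard_adj_and, ncard_hammingDist_eq_one_and, cosetGraph_dist, layer,
    Set.mem_ofPred_eq, sub_add_eq_add_sub]

lemma isOneErrorCorrecting_ker [DecidableEq ι] {V : Type*} [AddCommGroup V] [Module (ZMod 2) V]
    {σ : (ι → ZMod 2) →ₗ[ZMod 2] V} (h0 : ∀ j, σ (Pi.single j 1) ≠ 0)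
    (hinj : Function.Injective fun j => σ (Pi.single j 1)) :
    IsOneErrorCorrecting (LinearMap.ker σ) := by
  intro c hc hwt
  rw [LinearMap.mem_ker] at hc
  obtain h | h | h : hammingNorm c = 0 ∨ hammingNorm c = 1 ∨ hammingNorm c = 2 := by omega
  · exact hammingNorm_eq_zero.1 h
  · rw [← hammingDist_zero_left] at h
    obtain ⟨j, rfl⟩ := hammingDist_eq_one_iff.1 h
    exact absurd (by simpa using hc) (h0 j)
  · rw [← hammingDist_zero_left] at h
    obtain ⟨z, hz, hzc⟩ := exists_hammingDist_eq_and_eq_one h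
    obtain ⟨j, rfl⟩ := hammingDist_eq_one_iff.1 hz
    obtain ⟨k, rfl⟩ := hammingDist_eq_one_iff.1 hzc
    rw [zero_add, map_add, ← ZModModule.sub_eq_add, sub_eq_zero] at hc
    rw [zero_add, hinj hc, ZModModule.add_self]

theorem IsCompletelyRegularWith.isDistanceRegularWith_cosetGraph {ρ : ℕ} {b c : ℕ → ℕ}
    (h : IsCompletelyRegularWith (C : Set (ι → ZMod 2)) ρ b c) (hC : IsOneErrorCorrecting C) :
    IsDistanceRegularWith (cosetGraph (C : Set (ι → ZMod 2))) ρ b c where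
  connected := cosetGraph_connected C
  diam_eq := by rw [cosetGraph_diam, h.coveringRadius_eq]
  regular := ⟨Fintype.card ι, hC.ncard_neighborSet⟩
  up i hi u v huv := by
    obtain ⟨x, rfl⟩ := cosetOf_surjective u
    obtain ⟨y, rfl⟩ := cosetOf_surjective v
    rw [cosetGraph_dist] at huv
    rw [hC.ncard_adj_and_dist_eq, h.up i hi _ huv]
  down i h1 hi u v huv := by
    obtain ⟨x, rfl⟩ := cosetOf_surjective u
    obtain ⟨y, rfl⟩ := cosetOf_surjective v
    rw [cosetGraph_dist] at huv
    rw [hC.ncard_adj_and_dist_eq, h.down i h1 hi _ huv]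

end OneErrorCorrecting

section Cover

variable {ι : Type*} {C C' : Submodule (ZMod 2) (ι → ZMod 2)}

/-- The map that sends a coset of `C` to the coset of a larger code `C'` containing it. It is
defined through a representative, so it has this meaning only for `C ≤ C'`. -/
noncomputable def cosetProj (C C' : Submodule (ZMod 2) (ι → ZMod 2))
    (D : Coset (C : Set (ι → ZMod 2))) : Coset (C' : Set (ι → ZMod 2)) :=
  cosetOf C' (Function.surjInv cosetOf_surjective D)

lemma cosetProj_cosetOf (hle : C ≤ C') (x : ι → ZMod 2) :
    cosetProj C C' (cosetOf C x) = cosetOf C' x :=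
  cosetOf_eq_iff.2 (hle (cosetOf_eq_iff.1 (Function.surjInv_eq cosetOf_surjective _)))

lemma subset_cosetProj (hle : C ≤ C') (D : Coset (C : Set (ι → ZMod 2))) :
    D.1 ⊆ (cosetProj C C' D).1 := by
  obtain ⟨x, rfl⟩ := cosetOf_surjective D
  intro y hy
  rw [cosetProj_cosetOf hle]
  exact mem_cosetOf.2 (hle (mem_cosetOf.1 hy))

theorem isDoubleCover_cosetProj [Fintype ι] (hC' : IsOneErrorCorrecting C') {z : ι → ZMod 2}
    (hz : z ∉ C) (hmem : ∀ x, x ∈ C' ↔ x ∈ C ∨ x - z ∈ C) :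
    IsDoubleCover (cosetGraph (C : Set (ι → ZMod 2))) (cosetGraph (C' : Set (ι → ZMod 2)))
      (cosetProj C C') := by
  have hle : C ≤ C' := fun x hx => (hmem x).2 (.inl hx)
  constructor
  · intro D
    obtain ⟨x, rfl⟩ := cosetOf_surjective D
    refine Set.ncard_eq_two.2 ⟨cosetOf C x, cosetOf C (x + z), fun h => hz ?_, ?_⟩
    · simpa using cosetOf_eq_iff.1 h.symm
    · ext E
      obtain ⟨y, rfl⟩ := cosetOf_surjective E
      simp only [Set.mem_preimage, cosetProj_cosetOf hle, Set.mem_singleton_iff, Set.mem_insert_iff,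
        cosetOf_eq_iff, hmem, sub_sub]
  · intro D
    obtain ⟨x, rfl⟩ := cosetOf_surjective D
    have hbij := (hC'.mono hle).bijOn_cosetOf x
    have hcomp : cosetProj C C' ∘ cosetOf C = cosetOf C' := funext (cosetProj_cosetOf hle)
    rw [cosetProj_cosetOf hle, ← hbij.image_eq, ← Set.bijOn_comp_iff hbij.injOn, hcomp]
    exact hC'.bijOn_cosetOf x

lemma IsDoubleCover.natCard_eq {V W : Type*} [Finite W] {G : SimpleGraph V}
    {H : SimpleGraph W} {f : V → W} (hf : IsDoubleCover G H f) :
    Nat.card V = 2 * Nat.card W := by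
  have := Fintype.ofFinite W
  have hfib (w : W) : Nat.card {v // f v = w} = 2 := hf.1 w
  have hfin (w : W) : Finite {v // f v = w} :=
    Nat.finite_of_card_ne_zero (by rw [hfib]; exact two_ne_zero)
  rw [← Nat.card_congr (Equiv.sigmaFiberEquiv f), Nat.card_sigma]
  simp [hfib, mul_comm]

lemma natCard_coset_ker {V : Type*} [AddCommGroup V] [Module (ZMod 2) V]
    (σ : (ι → ZMod 2) →ₗ[ZMod 2] V) :
    Nat.card (Coset (LinearMap.ker σ : Set (ι → ZMod 2))) = Nat.card (LinearMap.range σ) := by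
  have hker : Setoid.ker (cosetOf (LinearMap.ker σ)) = Setoid.ker σ := by
    ext x y
    rw [Setoid.ker_def, Setoid.ker_def, cosetOf_eq_iff, LinearMap.sub_mem_ker_iff]
  rw [← Nat.card_congr (Setoid.quotientKerEquivOfSurjective _ cosetOf_surjective), hker]
  exact Nat.card_congr (Setoid.quotientKerEquivRange σ)

end Cover

section CompletelyTransitive

variable {ι : Type*} [Fintype ι] {C : Submodule (ZMod 2) (ι → ZMod 2)}

lemma exists_cosetGraph_iso (g : Equiv.Perm (ι → ZMod 2))
    (hg : ∀ x y, hammingDist (g x) (g y) = hammingDist x y)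
    (hgC : ∀ x y, g x - g y ∈ C ↔ x - y ∈ C) :
    ∃ π : cosetGraph (C : Set (ι → ZMod 2)) ≃g cosetGraph (C : Set (ι → ZMod 2)),
      ∀ x, π (cosetOf C x) = cosetOf C (g x) := by
  have himage (x : ι → ZMod 2) : g '' (cosetOf C x).1 = (cosetOf C (g x)).1 := by
    ext z
    obtain ⟨y, rfl⟩ := g.surjective z
    rw [g.injective.mem_set_image, mem_cosetOf, mem_cosetOf, hgC]
  have hstable (D : Set (ι → ZMod 2)) :
      (∃ x, D = (fun v => v + x) '' (C : Set (ι → ZMod 2))) ↔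
        ∃ x, Equiv.Set.congr g D = (fun v => v + x) '' (C : Set (ι → ZMod 2)) := by
    refine ⟨?_, ?_⟩
    · rintro ⟨x, rfl⟩
      exact ⟨g x, himage x⟩
    · rintro ⟨x, hx⟩
      refine ⟨g.symm x, g.injective.image_injective (Eq.trans hx ?_)⟩
      have h := himage (g.symm x)
      rw [g.apply_symm_apply] at h
      exact h.symm
  let e : Coset (C : Set (ι → ZMod 2)) ≃ Coset (C : Set (ι → ZMod 2)) :=
    (Equiv.Set.congr g).subtypeEquiv hstable
  refine ⟨⟨e, fun {D D'} => ?_⟩, fun x => Subtype.ext (himage x)⟩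
  change e D ≠ e D' ∧ (∃ v ∈ g '' D.1, ∃ v' ∈ g '' D'.1, hammingDist v v' = 1) ↔ _
  simp only [e.injective.ne_iff, Set.exists_mem_image, hg]
  rfl

lemma hammingNorm_comp_perm {β : Type*} [Zero β] [DecidableEq β] (τ : Equiv.Perm ι) (v : ι → β) :
    hammingNorm (v ∘ τ) = hammingNorm v :=
  Finset.card_equiv τ (by simp)

/-- Complete transitivity of a linear code, with only coordinate permutations preserving the code
taken into account: they act transitively on the cosets at any given distance from the code. -/
def IsCompletelyTransitive (C : Submodule (ZMod 2) (ι → ZMod 2)) : Prop :=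
  ∀ x y, distTo (C : Set (ι → ZMod 2)) x = distTo (C : Set (ι → ZMod 2)) y →
    ∃ τ : Equiv.Perm ι, (∀ c, c ∘ τ ∈ C ↔ c ∈ C) ∧ x ∘ τ - y ∈ C

theorem IsCompletelyTransitive.isDistanceTransitive_cosetGraph (hC : IsCompletelyTransitive C) :
    IsDistanceTransitive (cosetGraph (C : Set (ι → ZMod 2))) := by
  refine ⟨cosetGraph_connected C, fun u v u' v' h => ?_⟩
  obtain ⟨x, rfl⟩ := cosetOf_surjective u
  obtain ⟨y, rfl⟩ := cosetOf_surjective v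
  obtain ⟨x', rfl⟩ := cosetOf_surjective u'
  obtain ⟨y', rfl⟩ := cosetOf_surjective v'
  rw [cosetGraph_dist, cosetGraph_dist] at h
  obtain ⟨τ, hτC, hτ⟩ := hC _ _ h
  let g : Equiv.Perm (ι → ZMod 2) :=
    (Equiv.subRight x).trans ((τ.symm.arrowCongr (Equiv.refl _)).trans (Equiv.addRight x'))
  have hg (z : ι → ZMod 2) : g z = (z - x) ∘ τ + x' := rfl
  have hsub (z w : ι → ZMod 2) : g z - g w = (z - w) ∘ τ := by
    ext i
    simp [hg]
  obtain ⟨π, hπ⟩ := exists_cosetGraph_iso (C := C) g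
    (fun z w => by simp only [hammingDist_eq_hammingNorm_sub, hsub, hammingNorm_comp_perm])
    (fun z w => by rw [hsub, hτC])
  refine ⟨π, ?_, ?_⟩
  · rw [hπ, hg, sub_self]
    exact congrArg _ (zero_add x')
  · rw [hπ, hg, cosetOf_eq_iff, ← sub_sub_eq_add_sub]
    exact hτ

end CompletelyTransitive

section Primitivity

variable {ι : Type*} [Fintype ι] {C C' : Submodule (ZMod 2) (ι → ZMod 2)} {i : ℕ}

lemma distanceGraph_reachable_of_dist_eq {V : Type*} {G : SimpleGraph V} {u v : V}
    (h : G.dist u v = i) : (distanceGraph G i).Reachable u v := by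
  by_cases huv : u = v
  · exact huv ▸ SimpleGraph.Reachable.refl u
  · exact SimpleGraph.Adj.reachable ⟨huv, h⟩

lemma distanceGraph_cosetGraph_connected [DecidableEq ι]
    (h : ∀ j, ∃ x, distTo (C : Set (ι → ZMod 2)) x = i ∧
      distTo (C : Set (ι → ZMod 2)) (Pi.single j 1 - x) = i) :
    (distanceGraph (cosetGraph (C : Set (ι → ZMod 2))) i).Connected := by
  have hadj {D E : Coset (C : Set (ι → ZMod 2))}
      (hDE : (cosetGraph (C : Set (ι → ZMod 2))).Adj D E) :
      (distanceGraph (cosetGraph (C : Set (ι → ZMod 2))) i).Reachable D E := by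
    obtain ⟨y, rfl⟩ := cosetOf_surjective D
    obtain ⟨-, z, hz, rfl⟩ := cosetGraph_adj_cosetOf_iff.1 hDE
    obtain ⟨j, rfl⟩ := hammingDist_eq_one_iff.1 hz
    obtain ⟨x, hx, hjx⟩ := h j
    refine (distanceGraph_reachable_of_dist_eq (v := cosetOf C (y + x)) ?_).trans
      (distanceGraph_reachable_of_dist_eq ?_)
    · rwa [cosetGraph_dist, add_sub_cancel_left]
    · rwa [cosetGraph_dist, add_sub_add_left_eq_sub]
  refine ⟨fun D E => ?_⟩
  induction (cosetGraph_connected C).preconnected D E |>.some with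
  | nil => exact .refl _
  | cons hDE _ ih => exact (hadj hDE).trans ih

lemma not_connected_distanceGraph_cosetGraph (hC' : C' ≠ ⊤) (hle : C ≤ C')
    (h : ∀ x, distTo (C : Set (ι → ZMod 2)) x = i → x ∈ C') :
    ¬ (distanceGraph (cosetGraph (C : Set (ι → ZMod 2))) i).Connected := by
  intro hconn
  have hproj {D E : Coset (C : Set (ι → ZMod 2))}
      (w : (distanceGraph (cosetGraph (C : Set (ι → ZMod 2))) i).Walk D E) :
      cosetProj C C' D = cosetProj C C' E := by
    induction w with
    | nil => rfl
    | @cons D F _ hDF _ ih =>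
      refine Eq.trans ?_ ih
      obtain ⟨x, rfl⟩ := cosetOf_surjective D
      obtain ⟨y, rfl⟩ := cosetOf_surjective F
      rw [cosetProj_cosetOf hle, cosetProj_cosetOf hle, eq_comm, cosetOf_eq_iff]
      exact h _ (by rw [← cosetGraph_dist, hDF.2])
  refine hC' (eq_top_iff.2 fun x _ => ?_)
  have h0 := hproj (hconn.preconnected (cosetOf C x) (cosetOf C 0)).some
  rwa [cosetProj_cosetOf hle, cosetProj_cosetOf hle, cosetOf_eq_iff, sub_zero] at h0

end Primitivity

section Walsh

variable {ι : Type*} [Fintype ι]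

/-- The character `x ↦ (-1) ^ (y ⬝ᵥ x)` of the additive group `𝔽₂ⁿ`, as a real-valued function. -/
noncomputable def walsh (y : ι → ZMod 2) : AddChar (ι → ZMod 2) ℝ :=
  (AddChar.zmodChar 2 (ζ := (-1 : ℝ)) (by norm_num)).compAddMonoidHom
    (dotProductBilin (ZMod 2) (ZMod 2) y).toAddMonoidHom

lemma walsh_eq_ite (y x : ι → ZMod 2) : walsh y x = if y ⬝ᵥ x = 0 then 1 else -1 := by
  change (-1 : ℝ) ^ (y ⬝ᵥ x).val = _
  split_ifs with h
  · simp [h]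
  · simp [zmod_two_eq_one h, ZMod.val_one]

lemma walsh_eq_one_iff {y x : ι → ZMod 2} : walsh y x = 1 ↔ y ⬝ᵥ x = 0 := by
  rw [walsh_eq_ite]
  split_ifs with h <;> norm_num [h]

lemma walsh_comm (y x : ι → ZMod 2) : walsh y x = walsh x y := by
  rw [walsh_eq_ite, walsh_eq_ite, dotProduct_comm]

lemma walsh_mul_self (y x : ι → ZMod 2) : walsh y x * walsh y x = 1 := by
  rw [walsh_eq_ite]
  split_ifs <;> norm_num

variable [DecidableEq ι]

lemma sum_walsh_single (y : ι → ZMod 2) :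
    ∑ j, walsh y (Pi.single j 1) = Fintype.card ι - 2 * hammingNorm y := by
  have hterm (j : ι) : walsh y (Pi.single j 1) = 1 - 2 * if y j ≠ 0 then 1 else 0 := by
    rw [walsh_eq_ite, dotProduct_single_one]
    by_cases h : y j = 0 <;> norm_num [h]
  simp only [hterm, Finset.sum_sub_distrib, ← Finset.mul_sum, Finset.sum_boole, hammingNorm]
  simp

lemma sum_walsh_mul_sum (F : (ι → ZMod 2) → ℝ) (w : ι → ZMod 2) :
    ∑ y, walsh y w * ∑ x, F x * walsh y x = Fintype.card (ι → ZMod 2) * F w := by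
  have horth (x : ι → ZMod 2) :
      ∑ y, walsh y (w + x) = if x = w then (Fintype.card (ι → ZMod 2) : ℝ) else 0 := by
    have htriv : walsh (w + x) = 0 ↔ x = w := by
      refine ⟨fun h => ?_, ?_⟩
      · have hwx : w + x = 0 :=
          dotProduct_eq_zero _ fun y => walsh_eq_one_iff.1 (DFunLike.congr_fun h y)
        rw [← sub_eq_zero, ZModModule.sub_eq_add, add_comm, hwx]
      · rintro rfl
        ext y
        simp [walsh_eq_ite, ZModModule.add_self]
    simp only [walsh_comm _ (w + x), AddChar.sum_eq_ite, htriv]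
  have hmul (y x : ι → ZMod 2) : walsh y w * (F x * walsh y x) = F x * walsh y (w + x) := by
    rw [AddChar.map_add_eq_mul]
    ring
  simp only [Finset.mul_sum, hmul]
  rw [Finset.sum_comm]
  simp [← Finset.mul_sum, horth, mul_comm]

lemma exists_sum_mul_walsh_ne_zero {F : (ι → ZMod 2) → ℝ} (hF : F ≠ 0) :
    ∃ y, ∑ x, F x * walsh y x ≠ 0 := by
  obtain ⟨w, hw⟩ := Function.ne_iff.1 hF
  by_contra! h
  have hinv := sum_walsh_mul_sum F w
  simp only [h, mul_zero, Finset.sum_const_zero, zero_eq_mul, Nat.cast_eq_zero,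
    Fintype.card_ne_zero, false_or] at hinv
  exact hw hinv

lemma sum_add_mul_walsh (F : (ι → ZMod 2) → ℝ) (y a : ι → ZMod 2) :
    ∑ x, F (x + a) * walsh y x = walsh y a * ∑ x, F x * walsh y x := by
  rw [← Equiv.sum_comp (Equiv.addRight a) fun x => F x * walsh y x, Finset.mul_sum]
  refine Finset.sum_congr rfl fun x _ => ?_
  rw [Equiv.coe_addRight, AddChar.map_add_eq_mul]
  linear_combination (-F (x + a) * walsh y x) * walsh_mul_self y a

end Walsh

section DualCode

variable {ι : Type*} [Fintype ι] {C : Submodule (ZMod 2) (ι → ZMod 2)}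

/-- The dual of a binary linear code with respect to the standard bilinear form. -/
def dualCode (C : Submodule (ZMod 2) (ι → ZMod 2)) : Submodule (ZMod 2) (ι → ZMod 2) :=
  C.orthogonalBilin (dotProductBilin (ZMod 2) (ZMod 2))

lemma mem_dualCode {y : ι → ZMod 2} : y ∈ dualCode C ↔ ∀ c ∈ C, y ⬝ᵥ c = 0 := by
  simp [dualCode, dotProduct_comm]

lemma mem_dualCode_ker_mulVecLin {κ : Type*} [Fintype κ] {H : Matrix κ ι (ZMod 2)}
    {y : ι → ZMod 2} : y ∈ dualCode (LinearMap.ker H.mulVecLin) ↔ ∃ u, Matrix.vecMul u H = y := by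
  classical
  have hvecMul (u : κ → ZMod 2) : H.mulVecLin.dualMap (dotProductEquiv (ZMod 2) κ u) =
      dotProductEquiv (ZMod 2) ι (Matrix.vecMul u H) := by
    ext i
    simpa using Matrix.dotProduct_mulVec u H (Pi.single i 1)
  calc y ∈ dualCode (LinearMap.ker H.mulVecLin)
      ↔ dotProductEquiv (ZMod 2) ι y ∈ (LinearMap.ker H.mulVecLin).dualAnnihilator := by
        simp [mem_dualCode, Submodule.mem_dualAnnihilator]
    _ ↔ dotProductEquiv (ZMod 2) ι y ∈ LinearMap.range H.mulVecLin.dualMap := by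
        rw [LinearMap.range_dualMap_eq_dualAnnihilator_ker]
    _ ↔ ∃ u, Matrix.vecMul u H = y := by
        simp only [LinearMap.mem_range, (dotProductEquiv (ZMod 2) κ).surjective.exists, hvecMul,
          EmbeddingLike.apply_eq_iff_eq]

end DualCode

section Spectrum

variable {ι : Type*} [Fintype ι] {C : Submodule (ZMod 2) (ι → ZMod 2)}

lemma mem_eigenvalues_iff {V : Type*} [Fintype V] {G : SimpleGraph V} [G.LocallyFinite] {θ : ℝ} :
    θ ∈ eigenvalues G ↔ ∃ f : V → ℝ, f ≠ 0 ∧ ∀ v, ∑ w ∈ G.neighborFinset v, f w = θ * f v := by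
  classical
  have hmul (f : V → ℝ) :
      Matrix.toLin' (G.adjMatrix ℝ) f = θ • f ↔ ∀ v, ∑ w ∈ G.neighborFinset v, f w = θ * f v := by
    rw [funext_iff]
    refine forall_congr' fun v => ?_
    rw [Matrix.toLin'_apply, SimpleGraph.adjMatrix_mulVec_apply, Pi.smul_apply, smul_eq_mul]
    convert Iff.rfl
  simp only [← hmul]
  constructor
  · intro h
    obtain ⟨f, hf⟩ := Module.End.HasEigenvalue.exists_hasEigenvector h
    exact ⟨f, hf.2, by convert hf.apply_eq_smul⟩
  · rintro ⟨f, h0, hf⟩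
    refine Module.End.hasEigenvalue_of_hasEigenvector (x := f) ⟨?_, h0⟩
    rw [Module.End.mem_eigenspace_iff]
    convert hf

lemma IsOneErrorCorrecting.sum_neighborFinset [DecidableEq ι] (hC : IsOneErrorCorrecting C)
    [(cosetGraph (C : Set (ι → ZMod 2))).LocallyFinite]
    (f : Coset (C : Set (ι → ZMod 2)) → ℝ) (x : ι → ZMod 2) :
    ∑ D ∈ (cosetGraph (C : Set (ι → ZMod 2))).neighborFinset (cosetOf C x), f D =
      ∑ j, f (cosetOf C (x + Pi.single j 1)) := by
  have hbij := hC.bijOn_cosetOf x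
  refine (Finset.sum_nbij (fun j => cosetOf C (x + Pi.single j 1)) (fun j _ => ?_)
    (fun j _ k _ h => ?_) (fun D hD => ?_) fun _ _ => rfl).symm
  · exact (SimpleGraph.mem_neighborFinset ..).2
      (hbij.mapsTo (hammingDist_eq_one_iff.2 ⟨j, rfl⟩))
  · exact add_single_injective x (hbij.injOn (hammingDist_eq_one_iff.2 ⟨j, rfl⟩)
      (hammingDist_eq_one_iff.2 ⟨k, rfl⟩) h)
  · obtain ⟨y, hy, rfl⟩ := hbij.surjOn ((SimpleGraph.mem_neighborFinset ..).1 hD)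
    obtain ⟨j, rfl⟩ := hammingDist_eq_one_iff.1 hy
    exact ⟨j, Finset.mem_coe.2 (Finset.mem_univ j), rfl⟩

theorem IsOneErrorCorrecting.eigenvalues_cosetGraph (hC : IsOneErrorCorrecting C) :
    eigenvalues (cosetGraph (C : Set (ι → ZMod 2))) =
      {θ : ℝ | ∃ y ∈ dualCode C, θ = Fintype.card ι - 2 * hammingNorm y} := by
  classical
  ext θ
  rw [mem_eigenvalues_iff, Set.mem_ofPred_eq]
  simp only [← sum_walsh_single, mem_dualCode, ← walsh_eq_one_iff]
  constructor
  · rintro ⟨f, hf, heig⟩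
    obtain ⟨y, hy⟩ := exists_sum_mul_walsh_ne_zero (F := f ∘ cosetOf C)
      fun h => hf (cosetOf_surjective.injective_comp_right h)
    refine ⟨y, fun c hc => ?_, ?_⟩
    · have hinv (x : ι → ZMod 2) : (f ∘ cosetOf C) (x + c) = (f ∘ cosetOf C) x :=
        congrArg f (cosetOf_eq_iff.2 (by rwa [add_sub_cancel_left]))
      have h := sum_add_mul_walsh (f ∘ cosetOf C) y c
      simp only [hinv] at h
      exact (mul_eq_right₀ hy).1 h.symm
    · refine mul_right_cancel₀ hy ?_
      rw [Finset.sum_mul]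
      simp only [← sum_add_mul_walsh]
      rw [Finset.sum_comm, Finset.mul_sum]
      refine Finset.sum_congr rfl fun x _ => ?_
      rw [← Finset.sum_mul, Function.comp_apply, ← mul_assoc, ← heig, hC.sum_neighborFinset]
      rfl
  · rintro ⟨y, hy, rfl⟩
    let f (D : Coset (C : Set (ι → ZMod 2))) : ℝ := walsh y (Function.surjInv cosetOf_surjective D)
    have hf (x : ι → ZMod 2) : f (cosetOf C x) = walsh y x := by
      have h := hy _ (cosetOf_eq_iff.1 (Function.surjInv_eq cosetOf_surjective (cosetOf C x)))
      rw [show f (cosetOf C x) = walsh y _ from rfl, ← sub_add_cancel (Function.surjInv _ _) x,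
        AddChar.map_add_eq_mul, h, one_mul]
    refine ⟨f, fun h => ?_, fun D => ?_⟩
    · have h0 := hf 0
      rw [h, AddChar.map_zero_eq_one] at h0
      exact zero_ne_one h0
    · obtain ⟨x, rfl⟩ := cosetOf_surjective D
      rw [hC.sum_neighborFinset]
      simp only [hf, AddChar.map_add_eq_mul]
      rw [← Finset.mul_sum, mul_comm]

end Spectrum

section Weights

variable {α : Type*} [Fintype α]

/-- The support of a binary vector, which determines the vector. -/
def supp (v : α → ZMod 2) : Finset α := {i | v i ≠ 0}

lemma mem_supp {v : α → ZMod 2} {i : α} : i ∈ supp v ↔ v i ≠ 0 := by simp [supp]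

lemma card_supp (v : α → ZMod 2) : (supp v).card = hammingNorm v := rfl

lemma supp_injective : Function.Injective (supp (α := α)) := fun u v h => by
  ext i
  have hi : u i ≠ 0 ↔ v i ≠ 0 := by rw [← mem_supp, h, mem_supp]
  by_cases hu : u i = 0
  · rw [hu, not_not.1 (mt hi.2 (not_not.2 hu))]
  · rw [zmod_two_eq_one hu, zmod_two_eq_one (hi.1 hu)]

lemma supp_surjective : Function.Surjective (supp (α := α)) := fun S => by
  classical
  refine ⟨fun i => if i ∈ S then 1 else 0, ?_⟩
  ext i
  simp [mem_supp]

lemma exists_hammingNorm_eq {k : ℕ} (hk : k ≤ Fintype.card α) :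
    ∃ v : α → ZMod 2, hammingNorm v = k := by
  obtain ⟨S, -, hS⟩ := Finset.exists_subset_card_eq (s := (Finset.univ : Finset α)) hk
  obtain ⟨v, rfl⟩ := supp_surjective S
  exact ⟨v, hS⟩

lemma exists_perm_comp_eq {u v : α → ZMod 2} (h : hammingNorm u = hammingNorm v) :
    ∃ τ : Equiv.Perm α, u ∘ τ = v := by
  classical
  have hcard : Fintype.card {i // v i ≠ 0} = Fintype.card {i // u i ≠ 0} := by
    rw [Fintype.card_subtype, Fintype.card_subtype]
    exact h.symm
  let e := Fintype.equivOfCardEq hcard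
  refine ⟨e.extendSubtype, supp_injective ?_⟩
  ext i
  rw [mem_supp, mem_supp]
  exact ⟨not_imp_not.1 (e.extendSubtype_not_mem i), e.extendSubtype_mem i⟩

variable [DecidableEq α]

lemma supp_add (u v : α → ZMod 2) : supp (u + v) = symmDiff (supp u) (supp v) := by
  ext i
  simp only [mem_supp, Finset.mem_symmDiff, Pi.add_apply]
  generalize u i = a
  generalize v i = b
  revert a b
  decide

lemma hammingNorm_add (u v : α → ZMod 2) :
    hammingNorm (u + v) + 2 * (supp u ∩ supp v).card = hammingNorm u + hammingNorm v := by
  have hu := Finset.card_sdiff_add_card_inter (supp u) (supp v)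
  have hv := Finset.card_sdiff_add_card_inter (supp v) (supp u)
  rw [Finset.inter_comm] at hv
  rw [← card_supp, ← card_supp, ← card_supp, supp_add, symmDiff, Finset.sup_eq_union,
    Finset.card_union_of_disjoint disjoint_sdiff_sdiff]
  omega

lemma dotProduct_eq_card_inter (u v : α → ZMod 2) :
    u ⬝ᵥ v = ((supp u ∩ supp v).card : ZMod 2) := by
  rw [Finset.card_eq_sum_ones, supp, supp, ← Finset.filter_and, Finset.sum_filter, Nat.cast_sum]
  refine Finset.sum_congr rfl fun i _ => ?_
  generalize u i = a
  generalize v i = b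
  revert a b
  decide

omit [DecidableEq α]

lemma supp_one : supp (1 : α → ZMod 2) = Finset.univ := by
  ext i
  simp [mem_supp]

lemma hammingNorm_one : hammingNorm (1 : α → ZMod 2) = Fintype.card α := by
  rw [← card_supp, supp_one, Finset.card_univ]

lemma eq_one_of_hammingNorm_eq_card {v : α → ZMod 2} (h : hammingNorm v = Fintype.card α) :
    v = 1 := by
  apply supp_injective
  rw [supp_one, ← Finset.card_eq_iff_eq_univ, card_supp, h]

lemma hammingNorm_add_one (v : α → ZMod 2) :
    hammingNorm (v + 1) = Fintype.card α - hammingNorm v := by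
  classical
  have h := hammingNorm_add v 1
  rw [supp_one, Finset.inter_univ, card_supp, hammingNorm_one] at h
  omega

lemma even_hammingNorm_iff {v : α → ZMod 2} : Even (hammingNorm v) ↔ v ⬝ᵥ 1 = 0 := by
  classical
  rw [dotProduct_eq_card_inter, supp_one, Finset.inter_univ, card_supp,
    ZMod.natCast_eq_zero_iff_even]

lemma exists_hammingNorm_add_eq {u : α → ZMod 2} (hu : hammingNorm u = 2) {k : ℕ} (hk : 1 ≤ k)
    (hkα : k < Fintype.card α) :
    ∃ v, hammingNorm v = k ∧ hammingNorm (u + v) = k := by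
  classical
  obtain ⟨p, q, -, huv⟩ := Finset.card_eq_two.1 ((card_supp u).trans hu)
  obtain ⟨R, hR, hRcard⟩ := Finset.exists_subset_card_eq (s := (supp u)ᶜ) (n := k - 1)
    (by rw [Finset.card_compl, card_supp]; omega)
  have hpu : p ∈ supp u := by simp [huv]
  have hp : p ∉ R := fun h => Finset.mem_compl.1 (hR h) hpu
  obtain ⟨v, hv⟩ := supp_surjective (insert p R)
  have hvk : hammingNorm v = k := by
    rw [← card_supp, hv, Finset.card_insert_of_notMem hp]
    omega
  have hinter : supp u ∩ supp v = {p} := by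
    rw [hv, Finset.inter_insert_of_mem hpu,
      Finset.disjoint_iff_inter_eq_empty.1 (Finset.subset_compl_iff_disjoint_left.1 hR),
      insert_empty_eq]
  have h := hammingNorm_add u v
  rw [hinter, Finset.card_singleton] at h
  exact ⟨v, hvk, by omega⟩

lemma card_filter_card_inter_eq [DecidableEq α] (S : Finset α) (j k : ℕ) :
    (({T | T.card = j + k ∧ (S ∩ T).card = j} : Finset (Finset α))).card =
      S.card.choose j * (Fintype.card α - S.card).choose k := by
  rw [← Finset.card_compl, ← Finset.card_powersetCard, ← Finset.card_powersetCard,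
    ← Finset.card_product]
  have hsplit {A B : Finset α} (hA : A ⊆ S) (hB : B ⊆ Sᶜ) :
      S ∩ (A ∪ B) = A ∧ Sᶜ ∩ (A ∪ B) = B := by
    have hSB := Finset.subset_compl_iff_disjoint_left.1 hB
    have hSA : Disjoint Sᶜ A := disjoint_compl_left.mono_right hA
    simp [Finset.inter_union_distrib_left, Finset.disjoint_iff_inter_eq_empty.1 hSB,
      Finset.disjoint_iff_inter_eq_empty.1 hSA, Finset.inter_eq_right.2 hA,
      Finset.inter_eq_right.2 hB]
  refine Finset.card_nbij' (fun T => (S ∩ T, Sᶜ ∩ T)) (fun P => P.1 ∪ P.2) ?_ ?_ ?_ ?_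
  · intro T hT
    obtain ⟨hcard, hinter⟩ := (Finset.mem_filter.1 hT).2
    have hcompl : (Sᶜ ∩ T).card = k := by
      have h := Finset.card_inter_add_card_sdiff T S
      rw [Finset.inter_comm, Finset.sdiff_eq_inter_compl, Finset.inter_comm T Sᶜ] at h
      omega
    simp [hinter, hcompl, Finset.inter_subset_left]
  · rintro ⟨A, B⟩ hP
    obtain ⟨⟨hAS, hA⟩, hBS, hB⟩ : (A ⊆ S ∧ A.card = j) ∧ B ⊆ Sᶜ ∧ B.card = k := by
      simpa using hP
    have hAB : Disjoint A B := (Finset.subset_compl_iff_disjoint_left.1 hBS).mono_left hAS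
    simp [(hsplit hAS hBS).1, Finset.card_union_of_disjoint hAB, hA, hB]
  · intro T _
    simp [← Finset.union_inter_distrib_right]
  · rintro ⟨A, B⟩ hP
    obtain ⟨⟨hAS, -⟩, hBS, -⟩ : (A ⊆ S ∧ A.card = j) ∧ B ⊆ Sᶜ ∧ B.card = k := by
      simpa using hP
    exact Prod.ext (hsplit hAS hBS).1 (hsplit hAS hBS).2

end Weights

section WeightTwo

variable {m : ℕ}

lemma ncard_card_inter_eq (v : Fin m → ZMod 2) {j k : ℕ} (hjk : j + k = 2) :
    {e : WeightTwo m | (supp v ∩ supp e.1).card = j}.ncard =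
      (hammingNorm v).choose j * (m - hammingNorm v).choose k := by
  have himage : (fun e : WeightTwo m => supp e.1) '' {e | (supp v ∩ supp e.1).card = j} =
      (({T | T.card = j + k ∧ (supp v ∩ T).card = j} : Finset (Finset (Fin m))) : Set _) := by
    ext T
    obtain ⟨u, rfl⟩ := supp_surjective T
    simp [hjk, card_supp, supp_injective.eq_iff, and_comm]
  rw [← Set.ncard_image_of_injective _ (supp_injective.comp Subtype.val_injective)]
  change ((fun e : WeightTwo m => supp e.1) '' _).ncard = _
  rw [himage, Set.ncard_coe_finset, card_filter_card_inter_eq, card_supp, Fintype.card_fin]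

lemma card_weightTwo : Fintype.card (WeightTwo m) = m.choose 2 := by
  have h := ncard_card_inter_eq (0 : Fin m → ZMod 2) (zero_add 2)
  have h0 : supp (0 : Fin m → ZMod 2) = ∅ := by simp [supp]
  simpa [h0] using h

lemma hammingNorm_add_weightTwo (v : Fin m → ZMod 2) (e : WeightTwo m) :
    hammingNorm (v + e.1) + 2 * (supp v ∩ supp e.1).card = hammingNorm v + 2 ∧
      (supp v ∩ supp e.1).card ≤ 2 :=
  ⟨by rw [hammingNorm_add, e.2], (Finset.card_le_card Finset.inter_subset_right).trans e.2.le⟩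

end WeightTwo

section Syndrome

variable {m : ℕ}

/-- The syndrome `H_m x` of a vector `x`; it identifies the cosets of `C^{(m)}` with the vectors of
even weight in `𝔽₂ᵐ`. -/
noncomputable abbrev syndrome (m : ℕ) : (WeightTwo m → ZMod 2) →ₗ[ZMod 2] (Fin m → ZMod 2) :=
  (parityCheck m).mulVecLin

lemma syndrome_single (e : WeightTwo m) : syndrome m (Pi.single e 1) = e.1 := by
  ext i
  simp [parityCheck]

lemma vecMul_parityCheck (u : Fin m → ZMod 2) (e : WeightTwo m) :
    Matrix.vecMul u (parityCheck m) e = u ⬝ᵥ e.1 := rfl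

lemma even_hammingNorm_syndrome (x : WeightTwo m → ZMod 2) : Even (hammingNorm (syndrome m x)) := by
  have h1 : Matrix.vecMul 1 (parityCheck m) = 0 := by
    ext e
    rw [vecMul_parityCheck, dotProduct_comm, Pi.zero_apply, ← even_hammingNorm_iff, e.2]
    exact even_two
  rw [even_hammingNorm_iff, dotProduct_comm, Matrix.mulVecLin_apply, Matrix.dotProduct_mulVec, h1,
    zero_dotProduct]

lemma hammingNorm_syndrome_le (x : WeightTwo m → ZMod 2) :
    hammingNorm (syndrome m x) ≤ 2 * hammingNorm x := by
  have hsum : syndrome m x = ∑ e ∈ supp x, e.1 := by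
    ext i
    rw [Matrix.mulVecLin_apply, Finset.sum_apply, supp, Finset.sum_filter]
    refine Finset.sum_congr rfl fun e _ => ?_
    by_cases h : x e = 0
    · simp [h]
    · simp [zmod_two_eq_one h, parityCheck]
  calc hammingNorm (syndrome m x) ≤ ∑ e ∈ supp x, hammingNorm e.1 := by
        rw [hsum]
        exact Finset.le_sum_of_subadditive _ hammingNorm_zero.le
          (fun u v => by have := hammingNorm_add u v; omega) _ _
    _ = 2 * hammingNorm x := by
        rw [Finset.sum_congr rfl fun e _ => e.2, Finset.sum_const, card_supp, smul_eq_mul, mul_comm]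

lemma exists_syndrome_eq {v : Fin m → ZMod 2} (hv : Even (hammingNorm v)) :
    ∃ x, syndrome m x = v ∧ 2 * hammingNorm x ≤ hammingNorm v := by
  obtain ⟨n, hn⟩ := hv
  induction n generalizing v with
  | zero =>
    refine ⟨0, ?_, by simp⟩
    rw [map_zero, hammingNorm_eq_zero.1 hn]
  | succ n ih =>
    obtain ⟨e, he : (supp v ∩ supp e.1).card = 2⟩ :
        {e : WeightTwo m | (supp v ∩ supp e.1).card = 2}.Nonempty := by
      rw [← Set.ncard_pos, ncard_card_inter_eq v (add_zero 2), Nat.choose_zero_right, mul_one]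
      exact Nat.choose_pos (by omega)
    have hve := (hammingNorm_add_weightTwo v e).1
    obtain ⟨x, hx, hwt⟩ := ih (v := v + e.1) (by omega)
    refine ⟨x + Pi.single e 1, ?_, ?_⟩
    · rw [map_add, hx, syndrome_single, add_assoc, ZModModule.add_self, add_zero]
    · have h := hammingNorm_add x (Pi.single e 1)
      rw [hammingNorm_single e one_ne_zero] at h
      omega

lemma exists_syndrome_eq_iff {v : Fin m → ZMod 2} {n : ℕ} :
    (∃ x, syndrome m x = v ∧ hammingNorm x ≤ n) ↔ Even (hammingNorm v) ∧ hammingNorm v ≤ 2 * n := by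
  constructor
  · rintro ⟨x, rfl, hn⟩
    exact ⟨even_hammingNorm_syndrome x, (hammingNorm_syndrome_le x).trans (by omega)⟩
  · rintro ⟨hev, hn⟩
    obtain ⟨x, hx, hwt⟩ := exists_syndrome_eq hev
    exact ⟨x, hx, by omega⟩

lemma distTo_codeRound (x : WeightTwo m → ZMod 2) :
    distTo (codeRound m : Set (WeightTwo m → ZMod 2)) x = hammingNorm (syndrome m x) / 2 := by
  have hmem (z : WeightTwo m → ZMod 2) : x - z ∈ codeRound m ↔ syndrome m z = syndrome m x := by
    rw [codeRound, LinearMap.sub_mem_ker_iff, eq_comm]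
  obtain ⟨k, hk⟩ := even_hammingNorm_syndrome x
  refine eq_of_forall_ge_iff fun n => ?_
  simp only [distTo_le_iff, hmem, exists_syndrome_eq_iff, even_hammingNorm_syndrome, true_and]
  omega

/-- The vectors whose syndrome is a constant vector, zero or one. For even `m` this is `C^{[m]}`. -/
noncomputable def constantSyndromeCode (m : ℕ) : Submodule (ZMod 2) (WeightTwo m → ZMod 2) :=
  (Submodule.span (ZMod 2) {1}).comap (syndrome m)

lemma mem_constantSyndromeCode {x : WeightTwo m → ZMod 2} :
    x ∈ constantSyndromeCode m ↔ syndrome m x = 0 ∨ syndrome m x = 1 := by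
  rw [constantSyndromeCode, Submodule.mem_comap, Submodule.mem_span_singleton]
  constructor
  · rintro ⟨a, ha⟩
    rw [← ha]
    by_cases h : a = 0
    · exact .inl (by rw [h, zero_smul])
    · exact .inr (by rw [zmod_two_eq_one h, one_smul])
  · rintro (h | h)
    · exact ⟨0, by rw [h, zero_smul]⟩
    · exact ⟨1, by rw [h, one_smul]⟩

/-- Half the weight of the antipodal pair `{v, v + 1}`, that is, of its lighter member. -/
def foldedWeight (v : Fin m → ZMod 2) : ℕ := min (hammingNorm v) (m - hammingNorm v) / 2

lemma distTo_constantSyndromeCode (hev : Even m) (x : WeightTwo m → ZMod 2) :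
    distTo (constantSyndromeCode m : Set (WeightTwo m → ZMod 2)) x =
      foldedWeight (syndrome m x) := by
  have hmem (z : WeightTwo m → ZMod 2) : x - z ∈ constantSyndromeCode m ↔
      syndrome m z = syndrome m x ∨ syndrome m z = syndrome m x + 1 := by
    rw [mem_constantSyndromeCode, map_sub, sub_eq_zero, sub_eq_iff_eq_add', eq_comm,
      ← ZModModule.sub_eq_add, eq_sub_iff_add_eq, eq_comm (a := syndrome m x + 1)]
  have hwt := hammingNorm_add_one (syndrome m x)
  rw [Fintype.card_fin] at hwt
  have hx := even_hammingNorm_syndrome x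
  have hx1 : Even (hammingNorm (syndrome m x + 1)) := by
    rw [hwt]
    exact hev.tsub hx
  refine eq_of_forall_ge_iff fun n => ?_
  simp only [distTo_le_iff, hmem, or_and_right, exists_or, exists_syndrome_eq_iff, hx, hx1,
    true_and, foldedWeight]
  obtain ⟨k, hk⟩ := hx
  obtain ⟨l, hl⟩ := hx1
  omega

lemma isOneErrorCorrecting_codeRound (m : ℕ) : IsOneErrorCorrecting (codeRound m) := by
  refine isOneErrorCorrecting_ker (fun e h => ?_) fun e f h => ?_
  · have he := e.2
    rw [← syndrome_single e, h, hammingNorm_zero] at he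
    omega
  · exact Subtype.ext (by simpa only [syndrome_single] using h)

lemma isOneErrorCorrecting_constantSyndromeCode (hm : 4 < m) :
    IsOneErrorCorrecting (constantSyndromeCode m) := by
  intro c hc hwt
  obtain h | h := mem_constantSyndromeCode.1 hc
  · exact isOneErrorCorrecting_codeRound m c h hwt
  · have hle := hammingNorm_syndrome_le c
    rw [h, hammingNorm_one, Fintype.card_fin] at hle
    omega

lemma codeRound_le_constantSyndromeCode : codeRound m ≤ constantSyndromeCode m :=
  fun _ hx => mem_constantSyndromeCode.2 (.inl hx)

end Syndrome

section CompleteRegularity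

variable {m : ℕ}

lemma isCompletelyRegularWith_of_distTo_eq {C : Set (WeightTwo m → ZMod 2)}
    {w : (Fin m → ZMod 2) → ℕ} {ρ : ℕ} {b c : ℕ → ℕ} (hC : ∀ x, distTo C x = w (syndrome m x))
    (hle : ∀ v, w v ≤ ρ) (hex : ∃ v, Even (hammingNorm v) ∧ w v = ρ)
    (up : ∀ v, Even (hammingNorm v) → w v < ρ →
      {e : WeightTwo m | w (v + e.1) = w v + 1}.ncard = b (w v))
    (down : ∀ v, Even (hammingNorm v) → 1 ≤ w v →
      {e : WeightTwo m | w (v + e.1) = w v - 1}.ncard = c (w v)) :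
    IsCompletelyRegularWith C ρ b c where
  coveringRadius_eq := by
    refine coveringRadius_eq (fun x => (hC x).trans_le (hle _)) ?_
    obtain ⟨v, hv, hρ⟩ := hex
    obtain ⟨x, rfl, -⟩ := exists_syndrome_eq hv
    exact ⟨x, (hC x).trans hρ⟩
  up i hi x hx := by
    simp only [ncard_hammingDist_eq_one_and, layer, Set.mem_ofPred_eq, hC, map_add,
      syndrome_single] at hx ⊢
    subst hx
    exact up _ (even_hammingNorm_syndrome x) hi
  down i h1 _ x hx := by
    simp only [ncard_hammingDist_eq_one_and, layer, Set.mem_ofPred_eq, hC, map_add,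
      syndrome_single] at hx ⊢
    subst hx
    exact down _ (even_hammingNorm_syndrome x) h1

lemma hammingNorm_le (v : Fin m → ZMod 2) : hammingNorm v ≤ m :=
  hammingNorm_le_card_fintype.trans_eq (Fintype.card_fin m)

theorem isCompletelyRegularWith_codeRound (m : ℕ) :
    IsCompletelyRegularWith (codeRound m : Set (WeightTwo m → ZMod 2)) (m / 2) (arrB m) arrC := by
  refine isCompletelyRegularWith_of_distTo_eq distTo_codeRound
    (fun v => Nat.div_le_div_right (hammingNorm_le v)) ?_ (fun v hv _ => ?_) fun v hv h1 => ?_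
  · obtain ⟨v, hv⟩ := exists_hammingNorm_eq (α := Fin m) (k := 2 * (m / 2))
      (by rw [Fintype.card_fin]; omega)
    exact ⟨v, by rw [hv]; exact even_two_mul _, by omega⟩
  · have hset : {e : WeightTwo m | hammingNorm (v + e.1) / 2 = hammingNorm v / 2 + 1} =
        {e | (supp v ∩ supp e.1).card = 0} := by
      ext e
      have := hammingNorm_add_weightTwo v e
      simp only [Set.mem_ofPred_eq]
      omega
    rw [hset, ncard_card_inter_eq v (zero_add 2), Nat.choose_zero_right, one_mul, arrB,
      Nat.two_mul_div_two_of_even hv]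
  · have hset : {e : WeightTwo m | hammingNorm (v + e.1) / 2 = hammingNorm v / 2 - 1} =
        {e | (supp v ∩ supp e.1).card = 2} := by
      ext e
      have := hammingNorm_add_weightTwo v e
      simp only [Set.mem_ofPred_eq]
      omega
    rw [hset, ncard_card_inter_eq v (add_zero 2), Nat.choose_zero_right, mul_one, arrC,
      Nat.two_mul_div_two_of_even hv]

lemma hammingNorm_eq_of_foldedWeight_eq (hev : Even m) {v : Fin m → ZMod 2}
    (hv : Even (hammingNorm v)) :
    hammingNorm v = 2 * foldedWeight v ∨ hammingNorm v = m - 2 * foldedWeight v := by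
  have := hammingNorm_le v
  obtain ⟨k, hk⟩ := hv
  obtain ⟨n, hn⟩ := hev
  unfold foldedWeight
  omega

lemma foldedWeight_le (v : Fin m → ZMod 2) : foldedWeight v ≤ m / 4 := by
  unfold foldedWeight
  omega

lemma ncard_foldedWeight_add_eq_add_one (hev : Even m) {v : Fin m → ZMod 2}
    (hv : Even (hammingNorm v)) (hlt : foldedWeight v < m / 4) :
    {e : WeightTwo m | foldedWeight (v + e.1) = foldedWeight v + 1}.ncard =
      arrB m (foldedWeight v) := by
  obtain h | h := hammingNorm_eq_of_foldedWeight_eq hev hv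
  · have hset : {e : WeightTwo m | foldedWeight (v + e.1) = foldedWeight v + 1} =
        {e | (supp v ∩ supp e.1).card = 0} := by
      ext e
      have := hammingNorm_add_weightTwo v e
      simp only [Set.mem_ofPred_eq]
      rw [foldedWeight]
      omega
    rw [hset, ncard_card_inter_eq v (zero_add 2), Nat.choose_zero_right, one_mul, arrB, h]
  · have hset : {e : WeightTwo m | foldedWeight (v + e.1) = foldedWeight v + 1} =
        {e | (supp v ∩ supp e.1).card = 2} := by
      ext e
      have := hammingNorm_add_weightTwo v e
      simp only [Set.mem_ofPred_eq]
      rw [foldedWeight]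
      omega
    rw [hset, ncard_card_inter_eq v (add_zero 2), Nat.choose_zero_right, mul_one, arrB, h]

lemma ncard_foldedWeight_add_eq_sub_one_of_two_mul {v : Fin m → ZMod 2}
    (hv : 2 * hammingNorm v = m) (h1 : 1 ≤ foldedWeight v) :
    {e : WeightTwo m | foldedWeight (v + e.1) = foldedWeight v - 1}.ncard =
      2 * (hammingNorm v).choose 2 := by
  have hset : {e : WeightTwo m | foldedWeight (v + e.1) = foldedWeight v - 1} =
      {e | (supp v ∩ supp e.1).card = 0} ∪ {e | (supp v ∩ supp e.1).card = 2} := by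
    ext e
    have := hammingNorm_add_weightTwo v e
    simp only [Set.mem_ofPred_eq, Set.mem_union]
    unfold foldedWeight at *
    omega
  have hdisj : Disjoint {e : WeightTwo m | (supp v ∩ supp e.1).card = 0}
      {e | (supp v ∩ supp e.1).card = 2} :=
    Set.disjoint_left.2 fun e h0 h2 => absurd (h0.symm.trans h2) (by decide)
  rw [hset, Set.ncard_union_eq hdisj, ncard_card_inter_eq v (zero_add 2),
    ncard_card_inter_eq v (add_zero 2), Nat.choose_zero_right, Nat.choose_zero_right, one_mul,
    mul_one, show m - hammingNorm v = hammingNorm v by omega, two_mul]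

lemma ncard_foldedWeight_add_eq_sub_one (hev : Even m) {v : Fin m → ZMod 2}
    (hv : Even (hammingNorm v)) (h1 : 1 ≤ foldedWeight v) :
    {e : WeightTwo m | foldedWeight (v + e.1) = foldedWeight v - 1}.ncard =
      arrCSquare m (foldedWeight v) := by
  have hle := foldedWeight_le v
  by_cases hmid : m % 4 = 0 ∧ foldedWeight v = m / 4
  · have hwt : hammingNorm v = 2 * foldedWeight v := by
      obtain h | h := hammingNorm_eq_of_foldedWeight_eq hev hv <;> omega
    rw [ncard_foldedWeight_add_eq_sub_one_of_two_mul (by omega) h1, arrCSquare, if_pos hmid, hwt]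
  · rw [arrCSquare, if_neg hmid]
    obtain h | h := hammingNorm_eq_of_foldedWeight_eq hev hv
    · have hset : {e : WeightTwo m | foldedWeight (v + e.1) = foldedWeight v - 1} =
          {e | (supp v ∩ supp e.1).card = 2} := by
        ext e
        have := hammingNorm_add_weightTwo v e
        simp only [Set.mem_ofPred_eq]
        rw [foldedWeight]
        obtain ⟨n, hn⟩ := hev
        omega
      rw [hset, ncard_card_inter_eq v (add_zero 2), Nat.choose_zero_right, mul_one, h]
    · have hset : {e : WeightTwo m | foldedWeight (v + e.1) = foldedWeight v - 1} =
          {e | (supp v ∩ supp e.1).card = 0} := by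
        ext e
        have := hammingNorm_add_weightTwo v e
        simp only [Set.mem_ofPred_eq]
        rw [foldedWeight]
        obtain ⟨n, hn⟩ := hev
        omega
      rw [hset, ncard_card_inter_eq v (zero_add 2), Nat.choose_zero_right, one_mul, h]
      congr 1
      omega

theorem isCompletelyRegularWith_constantSyndromeCode (hev : Even m) :
    IsCompletelyRegularWith (constantSyndromeCode m : Set (WeightTwo m → ZMod 2)) (m / 4) (arrB m)
      (arrCSquare m) := by
  refine isCompletelyRegularWith_of_distTo_eq (distTo_constantSyndromeCode hev) foldedWeight_le ?_
    (fun v => ncard_foldedWeight_add_eq_add_one hev)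
    fun v => ncard_foldedWeight_add_eq_sub_one hev
  obtain ⟨v, hv⟩ := exists_hammingNorm_eq (α := Fin m) (k := 2 * (m / 4))
    (by rw [Fintype.card_fin]; omega)
  refine ⟨v, by rw [hv]; exact even_two_mul _, ?_⟩
  unfold foldedWeight
  omega

lemma coe_constantSyndromeCode (hev : Even m) :
    (constantSyndromeCode m : Set (WeightTwo m → ZMod 2)) = codeSquare m := by
  have hρ := (isCompletelyRegularWith_codeRound m).coveringRadius_eq
  ext x
  have hfar : hammingNorm (syndrome m x) / 2 = m / 2 ↔ syndrome m x = 1 := by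
    refine ⟨fun h => eq_one_of_hammingNorm_eq_card ?_, fun h => ?_⟩
    · obtain ⟨k, hk⟩ := even_hammingNorm_syndrome x
      obtain ⟨n, hn⟩ := hev
      rw [Fintype.card_fin]
      omega
    · rw [h, hammingNorm_one, Fintype.card_fin]
  rw [codeSquare, hρ, SetLike.mem_coe, mem_constantSyndromeCode, Set.mem_union, layer,
    Set.mem_ofPred_eq, distTo_codeRound, hfar]
  rfl

end CompleteRegularity

section Cardinality

variable {m : ℕ}

lemma range_syndrome (m : ℕ) :
    LinearMap.range (syndrome m) = LinearMap.ker (dotProductBilin (ZMod 2) (ZMod 2) 1) := by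
  ext v
  have hker : v ∈ LinearMap.ker (dotProductBilin (ZMod 2) (ZMod 2) 1) ↔ Even (hammingNorm v) := by
    rw [even_hammingNorm_iff, dotProduct_comm]
    rfl
  rw [hker]
  refine ⟨?_, fun hv => ?_⟩
  · rintro ⟨x, rfl⟩
    exact even_hammingNorm_syndrome x
  · obtain ⟨x, hx, -⟩ := exists_syndrome_eq hv
    exact ⟨x, hx⟩

lemma natCard_coset_codeRound (hm : 1 ≤ m) :
    Nat.card (Coset (codeRound m : Set (WeightTwo m → ZMod 2))) = 2 ^ (m - 1) := by
  let s : (Fin m → ZMod 2) →ₗ[ZMod 2] ZMod 2 := dotProductBilin (ZMod 2) (ZMod 2) 1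
  have hsurj : LinearMap.range s = ⊤ := by
    refine LinearMap.range_eq_top.2 fun a => ⟨Pi.single ⟨0, hm⟩ a, ?_⟩
    simp [s]
  have hrank := LinearMap.finrank_range_add_finrank_ker s
  rw [hsurj, finrank_top, Module.finrank_self, Module.finrank_fin_fun] at hrank
  rw [codeRound, natCard_coset_ker, range_syndrome, Module.natCard_eq_pow_finrank (K := ZMod 2),
    Nat.card_zmod]
  exact congrArg _ (Nat.eq_sub_of_add_eq' hrank)

lemma exists_syndrome_eq_one (hev : Even m) : ∃ z, syndrome m z = 1 := by
  obtain ⟨z, hz, -⟩ := exists_syndrome_eq (m := m) (v := 1)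
    (by rwa [hammingNorm_one, Fintype.card_fin])
  exact ⟨z, hz⟩

theorem isDoubleCover_cosetProj_constantSyndromeCode (hm : 4 < m) (hev : Even m) :
    IsDoubleCover (graphRound m)
      (cosetGraph (constantSyndromeCode m : Set (WeightTwo m → ZMod 2)))
      (cosetProj (codeRound m) (constantSyndromeCode m)) := by
  obtain ⟨z, hz⟩ := exists_syndrome_eq_one hev
  refine isDoubleCover_cosetProj (isOneErrorCorrecting_constantSyndromeCode hm) (z := z)
    (fun h => ?_) fun x => ?_
  · have h0 : (1 : Fin m → ZMod 2) = 0 := hz.symm.trans h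
    exact one_ne_zero (congrFun h0 ⟨0, by omega⟩)
  · rw [mem_constantSyndromeCode, codeRound, LinearMap.sub_mem_ker_iff, hz, LinearMap.mem_ker]

lemma natCard_coset_constantSyndromeCode (hm : 4 < m) (hev : Even m) :
    Nat.card (Coset (constantSyndromeCode m : Set (WeightTwo m → ZMod 2))) = 2 ^ (m - 2) := by
  have h := (isDoubleCover_cosetProj_constantSyndromeCode hm hev).natCard_eq
  rw [natCard_coset_codeRound (by omega), show m - 1 = m - 2 + 1 by omega, pow_succ'] at h
  exact (Nat.eq_of_mul_eq_mul_left two_pos h).symm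

end Cardinality

section Transitivity

variable {m : ℕ}

/-- The action of a permutation of the `m` coordinates on the vectors of weight two. -/
def permWeightTwo (τ : Equiv.Perm (Fin m)) : Equiv.Perm (WeightTwo m) :=
  (τ.symm.arrowCongr (Equiv.refl _)).subtypeEquiv fun v => by
    rw [← hammingNorm_comp_perm τ v]
    rfl

lemma syndrome_comp_perm (τ : Equiv.Perm (Fin m)) (x : WeightTwo m → ZMod 2) :
    syndrome m (x ∘ permWeightTwo τ) = syndrome m x ∘ τ.symm := by
  ext i
  refine (Finset.sum_congr rfl fun e _ => ?_).trans
    (Equiv.sum_comp (permWeightTwo τ) fun e => parityCheck m (τ.symm i) e * x e)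
  have he : parityCheck m (τ.symm i) (permWeightTwo τ e) = parityCheck m i e := by
    change e.1 (τ (τ.symm i)) = e.1 i
    rw [τ.apply_symm_apply]
  rw [he]
  rfl

lemma isCompletelyTransitive_comap_syndrome {U : Submodule (ZMod 2) (Fin m → ZMod 2)}
    (hU : ∀ (τ : Equiv.Perm (Fin m)) v, v ∘ τ ∈ U ↔ v ∈ U)
    (h : ∀ x y, distTo (U.comap (syndrome m) : Set (WeightTwo m → ZMod 2)) x =
        distTo (U.comap (syndrome m) : Set (WeightTwo m → ZMod 2)) y →
      ∃ u, hammingNorm (syndrome m x) = hammingNorm u ∧ u - syndrome m y ∈ U) :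
    IsCompletelyTransitive (U.comap (syndrome m)) := by
  intro x y hxy
  obtain ⟨u, hwt, hu⟩ := h x y hxy
  obtain ⟨τ, rfl⟩ := exists_perm_comp_eq hwt
  refine ⟨permWeightTwo τ.symm, fun c => ?_, ?_⟩
  · rw [Submodule.mem_comap, Submodule.mem_comap, syndrome_comp_perm, hU]
  · rwa [Submodule.mem_comap, map_sub, syndrome_comp_perm, Equiv.symm_symm]

theorem isCompletelyTransitive_codeRound (m : ℕ) : IsCompletelyTransitive (codeRound m) := by
  refine isCompletelyTransitive_comap_syndrome (U := ⊥) (fun τ v => ?_) fun x y h => ?_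
  · rw [Submodule.mem_bot, Submodule.mem_bot]
    exact τ.surjective.injective_comp_right.eq_iff (b := 0)
  · have h' := (distTo_codeRound x).symm.trans (h.trans (distTo_codeRound y))
    obtain ⟨k, hk⟩ := even_hammingNorm_syndrome x
    obtain ⟨l, hl⟩ := even_hammingNorm_syndrome y
    exact ⟨syndrome m y, by omega, by rw [sub_self]; exact Submodule.zero_mem _⟩

theorem isCompletelyTransitive_constantSyndromeCode (hev : Even m) :
    IsCompletelyTransitive (constantSyndromeCode m) := by
  refine isCompletelyTransitive_comap_syndrome (fun τ v => ?_) fun x y h => ?_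
  · simp only [Submodule.mem_span_singleton]
    exact exists_congr fun a =>
      τ.surjective.injective_comp_right.eq_iff (a := (a • 1 : Fin m → ZMod 2)) (b := v)
  · have h' := (distTo_constantSyndromeCode hev x).symm.trans
      (h.trans (distTo_constantSyndromeCode hev y))
    have hx := hammingNorm_eq_of_foldedWeight_eq hev (even_hammingNorm_syndrome x)
    have hy := hammingNorm_eq_of_foldedWeight_eq hev (even_hammingNorm_syndrome y)
    have hwt := hammingNorm_add_one (syndrome m y)
    have hle := foldedWeight_le (syndrome m y)
    rw [Fintype.card_fin] at hwt
    by_cases hxy : hammingNorm (syndrome m x) = hammingNorm (syndrome m y)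
    · exact ⟨syndrome m y, hxy, by rw [sub_self]; exact Submodule.zero_mem _⟩
    · refine ⟨syndrome m y + 1, by omega, ?_⟩
      rw [add_sub_cancel_left]
      exact Submodule.mem_span_singleton_self _

end Transitivity

section Primitivity

variable {m : ℕ}

theorem isPrimitive_cosetGraph_constantSyndromeCode (hev : Even m) :
    IsPrimitive (cosetGraph (constantSyndromeCode m : Set (WeightTwo m → ZMod 2))) := by
  refine ⟨cosetGraph_connected _, fun i h1 hi => distanceGraph_cosetGraph_connected fun e => ?_⟩
  rw [cosetGraph_diam, (isCompletelyRegularWith_constantSyndromeCode hev).coveringRadius_eq] at hi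
  obtain ⟨v, hv, huv⟩ := exists_hammingNorm_add_eq e.2 (k := 2 * i) (by omega)
    (by rw [Fintype.card_fin]; omega)
  obtain ⟨x, rfl, -⟩ := exists_syndrome_eq (v := v) (by rw [hv]; exact even_two_mul i)
  refine ⟨x, ?_, ?_⟩
  · rw [distTo_constantSyndromeCode hev, foldedWeight, hv]
    omega
  · rw [distTo_constantSyndromeCode hev, map_sub, syndrome_single, ZModModule.sub_eq_add,
      foldedWeight, huv]
    omega

theorem not_isPrimitive_graphRound (hm : 2 < m) (hev : Even m) : ¬ IsPrimitive (graphRound m) := by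
  have hρ := (isCompletelyRegularWith_codeRound m).coveringRadius_eq
  intro h
  refine not_connected_distanceGraph_cosetGraph (C' := constantSyndromeCode m) (fun htop => ?_)
    codeRound_le_constantSyndromeCode (fun x hx => ?_)
    (h.2 (m / 2) (by omega) (by rw [cosetGraph_diam, hρ]))
  · obtain ⟨v, hv⟩ := exists_hammingNorm_eq (α := Fin m) (k := 2) (by rw [Fintype.card_fin]; omega)
    have hmem : Pi.single ⟨v, hv⟩ 1 ∈ constantSyndromeCode m := htop ▸ Submodule.mem_top
    rw [mem_constantSyndromeCode, syndrome_single] at hmem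
    obtain rfl | rfl := hmem
    · simp at hv
    · rw [hammingNorm_one, Fintype.card_fin] at hv
      omega
  · rw [← SetLike.mem_coe, coe_constantSyndromeCode hev]
    exact .inr (by rw [hρ]; exact hx)

end Primitivity

section Eigenvalues

variable {m : ℕ}

lemma hammingNorm_vecMul_parityCheck (u : Fin m → ZMod 2) :
    hammingNorm (Matrix.vecMul u (parityCheck m)) = hammingNorm u * (m - hammingNorm u) := by
  have hset : (supp (Matrix.vecMul u (parityCheck m)) : Set (WeightTwo m)) =
      {e | (supp u ∩ supp e.1).card = 1} := by
    ext e
    have hle := (hammingNorm_add_weightTwo u e).2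
    rw [Finset.mem_coe, mem_supp, vecMul_parityCheck, dotProduct_eq_card_inter,
      ZMod.natCast_ne_zero_iff_odd, Set.mem_ofPred_eq, Nat.odd_iff]
    omega
  rw [← card_supp, ← Set.ncard_coe_finset, hset, ncard_card_inter_eq u one_add_one_eq_two,
    Nat.choose_one_right, Nat.choose_one_right]

lemma mem_dualCode_constantSyndromeCode (hev : Even m) {y : WeightTwo m → ZMod 2} :
    y ∈ dualCode (constantSyndromeCode m) ↔
      ∃ u, Even (hammingNorm u) ∧ Matrix.vecMul u (parityCheck m) = y := by
  have hpair (u : Fin m → ZMod 2) (x : WeightTwo m → ZMod 2) :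
      Matrix.vecMul u (parityCheck m) ⬝ᵥ x = u ⬝ᵥ syndrome m x :=
    (Matrix.dotProduct_mulVec _ _ _).symm
  rw [mem_dualCode]
  constructor
  · intro h
    have hy : y ∈ dualCode (codeRound m) :=
      mem_dualCode.2 fun c hc => h c (codeRound_le_constantSyndromeCode hc)
    obtain ⟨u, rfl⟩ := mem_dualCode_ker_mulVecLin.1 hy
    obtain ⟨z, hz⟩ := exists_syndrome_eq_one hev
    refine ⟨u, even_hammingNorm_iff.2 ?_, rfl⟩
    rw [← hz, ← hpair]
    exact h z (mem_constantSyndromeCode.2 (.inr hz))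
  · rintro ⟨u, hu, rfl⟩ c hc
    rw [hpair]
    obtain hc | hc := mem_constantSyndromeCode.1 hc
    · rw [hc, dotProduct_zero]
    · rw [hc, ← even_hammingNorm_iff]
      exact hu

theorem eigenvalues_cosetGraph_constantSyndromeCode (hm : 4 < m) (hev : Even m) :
    eigenvalues (cosetGraph (constantSyndromeCode m : Set (WeightTwo m → ZMod 2))) =
      {θ : ℝ | ∃ i : ℕ, i ≤ m / 4 ∧
        θ = (m.choose 2 : ℝ) - 8 * (i : ℝ) * (((m / 2 : ℕ) : ℝ) - (i : ℝ))} := by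
  have hform {k : ℕ} (hk : k ≤ m / 2) : ((2 * k * (m - 2 * k) : ℕ) : ℝ) =
      4 * (k : ℝ) * (((m / 2 : ℕ) : ℝ) - (k : ℝ)) := by
    rw [show m - 2 * k = 2 * (m / 2 - k) by obtain ⟨n, hn⟩ := hev; omega]
    push_cast [Nat.cast_sub hk]
    ring
  rw [(isOneErrorCorrecting_constantSyndromeCode hm).eigenvalues_cosetGraph, card_weightTwo]
  ext θ
  simp only [mem_dualCode_constantSyndromeCode hev, Set.mem_ofPred_eq]
  constructor
  · rintro ⟨_, ⟨u, ⟨k, hk⟩, rfl⟩, rfl⟩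
    have hle := hammingNorm_le u
    have hk2 : k ≤ m / 2 := by omega
    rw [hammingNorm_vecMul_parityCheck, hk, ← two_mul, hform hk2]
    obtain h | h := le_or_gt k (m / 4)
    · exact ⟨k, h, by ring⟩
    · refine ⟨m / 2 - k, by omega, ?_⟩
      push_cast [Nat.cast_sub hk2]
      ring
  · rintro ⟨i, hi, rfl⟩
    obtain ⟨u, hu⟩ := exists_hammingNorm_eq (α := Fin m) (k := 2 * i)
      (by rw [Fintype.card_fin]; omega)
    refine ⟨_, ⟨u, by rw [hu]; exact even_two_mul i, rfl⟩, ?_⟩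
    rw [hammingNorm_vecMul_parityCheck, hu, hform (by omega)]
    ring

end Eigenvalues

end CosetCode

theorem mainTheorem3 (m : ℕ) (hm : 6 ≤ m) (hev : Even m) :
    -- the code `C^{[m]}` is linear
    (∃ S : Submodule (ZMod 2) (CosetCode.WeightTwo m → ZMod 2),
      (S : Set (CosetCode.WeightTwo m → ZMod 2)) = CosetCode.codeSquare m) ∧
    -- numbers of vertices, and the double cover given by inclusion of cosets
    Nat.card (CosetCode.Coset (CosetCode.codeRound m : Set (CosetCode.WeightTwo m → ZMod 2)))
      = 2 ^ (m - 1) ∧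
    Nat.card (CosetCode.Coset (CosetCode.codeSquare m)) = 2 ^ (m - 2) ∧
    (∃ f : CosetCode.Coset (CosetCode.codeRound m : Set (CosetCode.WeightTwo m → ZMod 2)) →
        CosetCode.Coset (CosetCode.codeSquare m),
      (∀ D, D.1 ⊆ (f D).1) ∧
      CosetCode.IsDoubleCover (CosetCode.graphRound m) (CosetCode.graphSquare m) f) ∧
    -- the codes and their coset graphs have the same explicit intersection arrays
    CosetCode.IsCompletelyRegularWith
      (CosetCode.codeRound m : Set (CosetCode.WeightTwo m → ZMod 2)) (m / 2)
      (CosetCode.arrB m) CosetCode.arrC ∧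
    CosetCode.IsDistanceRegularWith (CosetCode.graphRound m) (m / 2)
      (CosetCode.arrB m) CosetCode.arrC ∧
    CosetCode.IsCompletelyRegularWith (CosetCode.codeSquare m) (m / 4)
      (CosetCode.arrB m) (CosetCode.arrCSquare m) ∧
    CosetCode.IsDistanceRegularWith (CosetCode.graphSquare m) (m / 4)
      (CosetCode.arrB m) (CosetCode.arrCSquare m) ∧
    -- distance-transitivity
    CosetCode.IsDistanceTransitive (CosetCode.graphRound m) ∧
    CosetCode.IsDistanceTransitive (CosetCode.graphSquare m) ∧
    -- imprimitivity and primitivity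
    ¬ CosetCode.IsPrimitive (CosetCode.graphRound m) ∧
    CosetCode.IsPrimitive (CosetCode.graphSquare m) ∧
    -- eigenvalues
    (m % 4 = 2 → CosetCode.eigenvalues (CosetCode.graphSquare m) =
      {θ : ℝ | ∃ i : ℕ, i ≤ m / 4 ∧
        θ = (m.choose 2 : ℝ) - 8 * (i : ℝ) * (2 * ((m / 4 : ℕ) : ℝ) + 1 - (i : ℝ))}) ∧
    (m % 4 = 0 → CosetCode.eigenvalues (CosetCode.graphSquare m) =
      {θ : ℝ | ∃ i : ℕ, i ≤ m / 4 ∧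
        θ = (m.choose 2 : ℝ) - 8 * (i : ℝ) * (2 * ((m / 4 : ℕ) : ℝ) - (i : ℝ))}) := by
  have hcs := CosetCode.coe_constantSyndromeCode hev
  have hround := CosetCode.isOneErrorCorrecting_codeRound m
  have hsquare := CosetCode.isOneErrorCorrecting_constantSyndromeCode (by omega : 4 < m)
  have hregRound := CosetCode.isCompletelyRegularWith_codeRound m
  have hregSquare := CosetCode.isCompletelyRegularWith_constantSyndromeCode hev
  have heig := CosetCode.eigenvalues_cosetGraph_constantSyndromeCode (by omega : 4 < m) hev
  refine ⟨⟨_, hcs⟩, ?_⟩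
  simp only [CosetCode.graphSquare]
  rw [← hcs]
  refine ⟨CosetCode.natCard_coset_codeRound (by omega),
    CosetCode.natCard_coset_constantSyndromeCode (by omega) hev,
    ⟨_, CosetCode.subset_cosetProj CosetCode.codeRound_le_constantSyndromeCode,
      CosetCode.isDoubleCover_cosetProj_constantSyndromeCode (by omega) hev⟩,
    hregRound, hregRound.isDistanceRegularWith_cosetGraph hround,
    hregSquare, hregSquare.isDistanceRegularWith_cosetGraph hsquare,
    (CosetCode.isCompletelyTransitive_codeRound m).isDistanceTransitive_cosetGraph,
    (CosetCode.isCompletelyTransitive_constantSyndromeCode hev).isDistanceTransitive_cosetGraph,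
    CosetCode.not_isPrimitive_graphRound (by omega) hev,
    CosetCode.isPrimitive_cosetGraph_constantSyndromeCode hev, fun h => ?_, fun h => ?_⟩
  · rw [heig, show m / 2 = 2 * (m / 4) + 1 by omega]
    push_cast
    rfl
  · rw [heig, show m / 2 = 2 * (m / 4) by omega]
    push_cast
    rfl
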